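/- **Setting.** Let $n\ge 3$, let $m_1,\dots,m_n>0$, let $M=\mathrm{diag}(m_1I_4,\dots,m_nI_4)$ and let $U(q)=\sum_{i<j}\frac{m_im_j}{|q_i-q_j|}$ be the Newtonian potential on collision-free configurations $q=(q_1,\dots,q_n)\in(\mathbb R^4)^n$. A *central configuration* is a collision-free $q$ with $\sum_i m_iq_i=0$ and $$\nabla U(q)+\lambda Mq=0,\qquad \lambda=\frac{U(q)}{\langle Mq,q\rangle}.$$ Put $k=\sqrt\lambda$ and let $R_d(t)$ act on each copy of $\mathbb R^4$ by $\mathrm{diag}(\Theta(t),\Theta(-t))$, where $\Theta(t)$ is the rotation of $\mathbb R^2$ by the angle $kt$. The *relative equilibrium* (RE) generated by $q$ is $\gamma(t)=R_d(t)q$. It is *planar* if all bodies stay for all times in one fixed $2$-dimensional linear subspace $P\subset\mathbb R^4$. The configuration $q$ is *collinear* if $q_1,\dots,q_n$ lie on one line. **Linearization.** Let $\mathbf i,\mathbf j,\mathbf k$ be the real $4\times4$ matrices of left multiplication by the quaternion units, with $\mathbf i=\mathrm{diag}(i,-i)$, $i=\begin{pmatrix}0&-1\\1&0\end{pmatrix}$.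 Let $k_d=k\,\mathbf i$ be the generator of $R_d$. If $\gamma$ is planar with plane $P$, let $k_s$ be the operator equal to $k_d$ on $P$ and to $0$ on $P^\perp$; thus $k_s=k\,\mathrm{diag}(i,0)$ if $P=\mathbb R^2\times\{0\}$. For $*\in\{d,s\}$ let $K_*=\mathrm{diag}(k_*,\dots,k_*)$ and $$L_*=\begin{pmatrix}K_*&M^{-1}\\ D^2U(q)&K_*\end{pmatrix},\qquad B_*=JL_*=\begin{pmatrix}-D^2U(q)&-K_*\\K_*&M^{-1}\end{pmatrix},\qquad J=\begin{pmatrix}0&-I\\I&0\end{pmatrix}$$ on $\mathbb R^{8n}$, with symplectic form $\omega_0=\langle J\cdot,\cdot\rangle$. Let $$E_1=\{(v,\dots,v,m_1w,\dots,m_nw): v,w\in\mathbb R^4\},$$ $$E_2^d=\mathrm{span}\{(aq,0),(0,aMq): a\in\{1,\mathbf i,\mathbf j,\mathbf k\}\},$$ $$E_2^s=\mathrm{span}\{(q,0),(0,Mq),(K_{lr}q,0),(0,MK_{lr}q): 1\le l<r\le4\},$$ where $K_{lr}$ acts on each copy of $\mathbb R^4$ by the infinitesimal rotation of the $(l,r)$-coordinate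 plane. Let $E_3^*$ be the $\omega_0$-orthogonal complement of $E_1\oplus E_2^*$. For $*=d$, and for $*=s$ when $\gamma$ is planar, it is an $L_*$-invariant symplectic subspace; let $B_3^*$ be the symmetric form obtained by restricting $B_*$ to $E_3^*$, and $JB_3^*$ the restriction of $JB_*=-L_*$ to $E_3^*$. Write $n^-$ for the number of negative eigenvalues (negative inertia index). The RE $\gamma$ is *spectrally stable* if all complex eigenvalues of $L_*|_{E_3^*}$ are purely imaginary, where $*=s$ if $\gamma$ is planar and $*=d$ otherwise, and *spectrally unstable* if it is not spectrally stable. **Theorem.** Let $\gamma$ be the RE in $\mathbb R^4$ generated by a central configuration $q$. 1. If $\gamma$ is non-planar, or $\gamma$ is planar and $q$ is collinear, and if $$n^-\bigl(B_3^d|_{\ker(JB_3^d)^{8n-16}}\bigr)-n^-(B_3^d)\equiv1\pmod 2,$$ then $\gamma$ is spectrally unstable. If $\gamma$ is planar and $q$ is collinear, the same conclusion holds if the congruence holds with $B_3^s$ in place of $B_3^d$. 2. If $\gamma$ is planar and $q$ is not collinear, and if $$n^-\bigl(B_3^s|_{\ker(JB_3^s)^{8n-20}}\bigr)-n^-(B_3^s)\equiv1\pmod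 2,$$ then $\gamma$ is spectrally unstable. -/

import Mathlib

open scoped TensorProduct

noncomputable section

namespace RelEq

/-! ### Configurations, potential, central configurations -/

/-- Euclidean four-space. -/
abbrev E4 := EuclideanSpace ℝ (Fin 4)

/-- Configurations of `n` particles in `ℝ⁴`, with the Euclidean structure of `ℝ⁴ⁿ`. -/
abbrev Config (n : ℕ) := PiLp 2 (fun _ : Fin n => E4)

variable {n : ℕ}

/-- The Newtonian potential `U(q) = ∑_{i<j} mᵢ mⱼ / |qᵢ - qⱼ|`. -/
def potential (m : Fin n → ℝ) (q : Config n) : ℝ :=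
  ∑ i, ∑ j ∈ Finset.Ioi i, m i * m j / ‖q i - q j‖

/-- The block diagonal operator `diag(a₁, …, aₙ)` of `ℝ⁴ⁿ` with `4 × 4` blocks `aᵢ`. -/
def blockDiag (a : Fin n → (E4 →ₗ[ℝ] E4)) : Config n →ₗ[ℝ] Config n where
  toFun x := WithLp.toLp 2 (fun i => a i (x i))
  map_add' x y := by ext i; simp
  map_smul' c x := by ext i; simp

/-- The mass matrix `M = diag(m₁ I₄, …, mₙ I₄)`. -/
def massOp (m : Fin n → ℝ) : Config n →ₗ[ℝ] Config n :=
  blockDiag (fun i => m i • LinearMap.id)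

/-- The inverse `M⁻¹` of the mass matrix (for non-zero masses). -/
def massInv (m : Fin n → ℝ) : Config n →ₗ[ℝ] Config n :=
  blockDiag (fun i => (m i)⁻¹ • LinearMap.id)

/-- The diagonal action on `ℝ⁴ⁿ` of a linear operator of `ℝ⁴`. -/
def diagAct (a : E4 →ₗ[ℝ] E4) : Config n →ₗ[ℝ] Config n :=
  blockDiag (fun _ => a)

/-- The moment of inertia `⟨Mq, q⟩`. -/
def inertia (m : Fin n → ℝ) (q : Config n) : ℝ := inner ℝ (massOp m q) q

/-- `q` is a central configuration: it has no collisions, its centre of mass is at the origin,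
and `∇U(q) + λ M q = 0` with `λ = U(q) / ⟨Mq, q⟩`. -/
structure IsCentralConfiguration (m : Fin n → ℝ) (q : Config n) : Prop where
  collisionFree : ∀ i j, i ≠ j → q i ≠ q j
  center : ∑ i, m i • q i = 0
  balance : gradient (potential m) q + (potential m q / inertia m q) • massOp m q = 0

/-- All bodies lie on one line. -/
def IsCollinear (q : Config n) : Prop := Collinear ℝ (Set.range (fun i => q i))

/-! ### The relative equilibrium -/

/-- The angular speed `k = √λ`, `λ = U(q) / ⟨Mq, q⟩`. -/
def angSpeed (m : Fin n → ℝ) (q : Config n) : ℝ := √(potential m q / inertia m q)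

/-- The double rotation `diag(Θ, Θ⁻¹)`, `Θ` being the rotation of the plane by the angle `φ`. -/
def doubleRotation (φ : ℝ) : Matrix (Fin 4) (Fin 4) ℝ :=
  !![Real.cos φ, -Real.sin φ, 0, 0;
     Real.sin φ, Real.cos φ, 0, 0;
     0, 0, Real.cos φ, Real.sin φ;
     0, 0, -Real.sin φ, Real.cos φ]

/-- The (circular) relative equilibrium `γ(t) = R_d(t) q` generated by `q`. -/
def relEquilibrium (m : Fin n → ℝ) (q : Config n) (t : ℝ) : Config n :=
  diagAct (Matrix.toEuclideanLin (doubleRotation (angSpeed m q * t))) q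

/-- The relative equilibrium generated by `q` is planar: the motion takes place in a fixed
two-dimensional plane. -/
def IsPlanarRE (m : Fin n → ℝ) (q : Config n) : Prop :=
  ∃ P : Submodule ℝ E4, Module.finrank ℝ P = 2 ∧ ∀ t i, relEquilibrium m q t i ∈ P

/-- The linear span in `ℝ⁴` of all the positions taken by the bodies along the relative
equilibrium; for a planar relative equilibrium, the plane of the motion. -/
def motionSpan (m : Fin n → ℝ) (q : Config n) : Submodule ℝ E4 :=
  Submodule.span ℝ {x | ∃ t i, x = relEquilibrium m q t i}

/-! ### The rotating frames -/

/-- The quaternion unit `i` as a real `4 × 4` matrix. -/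
def quatI : Matrix (Fin 4) (Fin 4) ℝ :=
  !![0, -1, 0, 0; 1, 0, 0, 0; 0, 0, 0, 1; 0, 0, -1, 0]

/-- The quaternion unit `j` as a real `4 × 4` matrix. -/
def quatJ : Matrix (Fin 4) (Fin 4) ℝ :=
  !![0, 0, 1, 0; 0, 0, 0, 1; -1, 0, 0, 0; 0, -1, 0, 0]

/-- The quaternion unit `k` as a real `4 × 4` matrix. -/
def quatK : Matrix (Fin 4) (Fin 4) ℝ :=
  !![0, 0, 0, -1; 0, 0, 1, 0; 0, -1, 0, 0; 1, 0, 0, 0]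

/-- The generator `k_d = k diag(i, -i)` of the double rotation `R_d`. -/
def genDouble (m : Fin n → ℝ) (q : Config n) : E4 →ₗ[ℝ] E4 :=
  angSpeed m q • Matrix.toEuclideanLin quatI

/-- The generator `k_s` of the simple rotation which has the same effect as `R_d` on the plane of
a planar relative equilibrium and which fixes the orthogonal complement of that plane pointwise.
When the plane is `ℝ² × {0}` this is `k_s = k diag(i, 0)`. -/
def genSimple (m : Fin n → ℝ) (q : Config n) : E4 →ₗ[ℝ] E4 :=
  genDouble m q ∘ₗ (motionSpan m q).starProjection.toLinearMap

/-! ### The linearized Hamiltonian system -/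

/-- The phase space `T*ℝ⁴ⁿ = ℝ⁸ⁿ`, with elements `(x, p)`. -/
abbrev Phase (n : ℕ) := Config n × Config n

/-- The Euclidean scalar product of `ℝ⁸ⁿ`. -/
def dot : LinearMap.BilinForm ℝ (Phase n) :=
  LinearMap.mk₂ ℝ (fun z w => inner ℝ z.1 w.1 + inner ℝ z.2 w.2)
    (fun z z' w => by simp only [Prod.fst_add, Prod.snd_add, inner_add_left]; ring)
    (fun c z w => by
      simp only [Prod.smul_fst, Prod.smul_snd, real_inner_smul_left, smul_eq_mul]; ring)
    (fun z w w' => by simp only [Prod.fst_add, Prod.snd_add, inner_add_right]; ring)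
    (fun c z w => by
      simp only [Prod.smul_fst, Prod.smul_snd, real_inner_smul_right, smul_eq_mul]; ring)

/-- The standard complex structure `J (x, p) = (-p, x)`. -/
def stdJ : Phase n →ₗ[ℝ] Phase n :=
  LinearMap.prod (-LinearMap.snd ℝ (Config n) (Config n)) (LinearMap.fst ℝ (Config n) (Config n))

/-- The standard symplectic form `ω₀(z, w) = ⟨J z, w⟩`. -/
def omega : LinearMap.BilinForm ℝ (Phase n) := dot ∘ₗ stdJ

/-- The second derivative `D²U(q)` of the potential, as a linear operator of `ℝ⁴ⁿ`. -/
def hessU (m : Fin n → ℝ) (q : Config n) : Config n →ₗ[ℝ] Config n :=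
  (fderiv ℝ (gradient (potential m)) q).toLinearMap

/-- The Hamiltonian matrix `L = (K, M⁻¹; D²U(q), K)` of the linearization at `q` of the equations
of motion in the rotating frame with generator `a`, where `K = diag(a, …, a)`. -/
def hamL (m : Fin n → ℝ) (q : Config n) (a : E4 →ₗ[ℝ] E4) : Phase n →ₗ[ℝ] Phase n :=
  LinearMap.prod
    (diagAct a ∘ₗ LinearMap.fst ℝ (Config n) (Config n) +
      massInv m ∘ₗ LinearMap.snd ℝ (Config n) (Config n))
    (hessU m q ∘ₗ LinearMap.fst ℝ (Config n) (Config n) +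
      diagAct a ∘ₗ LinearMap.snd ℝ (Config n) (Config n))

/-- The symmetric matrix `B = J L = (-D²U(q), -K; K, M⁻¹)`, so that `L = -J B`. -/
def matB (m : Fin n → ℝ) (q : Config n) (a : E4 →ₗ[ℝ] E4) : Phase n →ₗ[ℝ] Phase n :=
  stdJ ∘ₗ hamL m q a

/-- The quadratic form `z ↦ ⟨B z, z⟩`. -/
def formB (m : Fin n → ℝ) (q : Config n) (a : E4 →ₗ[ℝ] E4) : QuadraticForm ℝ (Phase n) :=
  LinearMap.BilinMap.toQuadraticMap (dot ∘ₗ matB m q a)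

/-! ### The invariant symplectic subspaces -/

/-- `E₁ = {(v, …, v, m₁ w, …, mₙ w)}`, `v, w ∈ ℝ⁴`. -/
def E1 (m : Fin n → ℝ) : Submodule ℝ (Phase n) :=
  Submodule.span ℝ {z | ∃ v w : E4,
    z = (WithLp.toLp 2 (fun _ => v), WithLp.toLp 2 (fun i => m i • w))}

/-- `E₂ᵈ`, the span of `(a q, 0)` and `(0, a M q)` for `a` among the quaternions `1, i, j, k`. -/
def E2d (m : Fin n → ℝ) (q : Config n) : Submodule ℝ (Phase n) :=
  Submodule.span ℝ {z | ∃ a ∈ ({1, quatI, quatJ, quatK} : Set (Matrix (Fin 4) (Fin 4) ℝ)),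
    z = (diagAct (Matrix.toEuclideanLin a) q, 0) ∨
    z = (0, diagAct (Matrix.toEuclideanLin a) (massOp m q))}

/-- The generator `k_{lr}` of the rotations of the `(l, r)`-coordinate plane: entry `-1` at
`(l, r)`, entry `1` at `(r, l)`, and `0` elsewhere. -/
def genRot (l r : Fin 4) : Matrix (Fin 4) (Fin 4) ℝ :=
  Matrix.single r l 1 - Matrix.single l r 1

/-- `E₂ˢ`, the span of `(q, 0)`, `(0, M q)` and of all `(K_{lr} q, 0)`, `(0, M K_{lr} q)`. If `q`
lies in the plane `ℝ² × {0}`, then `K_{34} q = 0`, so that this pair may be left out. -/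
def E2s (m : Fin n → ℝ) (q : Config n) : Submodule ℝ (Phase n) :=
  Submodule.span ℝ ({(q, 0), (0, massOp m q)} ∪ {z | ∃ l r : Fin 4, l < r ∧
    (z = (diagAct (Matrix.toEuclideanLin (genRot l r)) q, 0) ∨
     z = (0, massOp m (diagAct (Matrix.toEuclideanLin (genRot l r)) q)))})

/-- `E₃ᵈ`, the symplectic orthogonal complement of `E₁ ⊕ E₂ᵈ`. -/
def E3d (m : Fin n → ℝ) (q : Config n) : Submodule ℝ (Phase n) :=
  omega.orthogonal (E1 m ⊔ E2d m q)

/-- `E₃ˢ`, the symplectic orthogonal complement of `E₁ ⊕ E₂ˢ`. -/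
def E3s (m : Fin n → ℝ) (q : Config n) : Submodule ℝ (Phase n) :=
  omega.orthogonal (E1 m ⊔ E2s m q)

/-! ### Inertia indices and spectral stability -/

/-- `n⁻(B₃)`, the negative inertia index of the restriction `B₃` of `B` to `E₃`. -/
def indexB3 (m : Fin n → ℝ) (q : Config n) (a : E4 →ₗ[ℝ] E4)
    (E₃ : Submodule ℝ (Phase n)) : ℕ :=
  _root_.sigNeg ((formB m q a).restrict E₃)

/-- `n⁻(B₃|_{ker (J B₃)^N})`. Since `E₃` is invariant, `J B₃` is the restriction of `J B` to `E₃`,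
so that `ker (J B₃)^N = E₃ ∩ ker (J B)^N`. -/
def indexB3Ker (m : Fin n → ℝ) (q : Config n) (a : E4 →ₗ[ℝ] E4)
    (E₃ : Submodule ℝ (Phase n)) (N : ℕ) : ℕ :=
  _root_.sigNeg
    ((formB m q a).restrict (E₃ ⊓ LinearMap.ker ((stdJ ∘ₗ matB m q a) ^ N)))

/-- The eigenvalues (in `ℂ`) of the restriction of `L` to the invariant subspace `E₃` are all
purely imaginary. An eigenvalue of the restriction is an eigenvalue of the complexification of `L`
with an eigenvector in the complexification of `E₃`. -/
def IsStableOn (L : Phase n →ₗ[ℝ] Phase n) (E₃ : Submodule ℝ (Phase n)) : Prop :=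
  ∀ μ : ℂ, (∃ v ∈ E₃.baseChange ℂ, v ≠ 0 ∧ L.baseChange ℂ v = μ • v) → μ.re = 0

open Classical in
/-- Spectral stability of the relative equilibrium generated by `q`: the Hamiltonian matrix on
`E₃` has purely imaginary spectrum. The simple rotating frame is used for a planar relative
equilibrium, the double one otherwise. -/
def IsSpectrallyStable (m : Fin n → ℝ) (q : Config n) : Prop :=
  if IsPlanarRE m q then IsStableOn (hamL m q (genSimple m q)) (E3s m q)
  else IsStableOn (hamL m q (genDouble m q)) (E3d m q)

end RelEq

end

/-! ### Negative inertia index and orthogonal decompositions -/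

section Inertia

open QuadraticMap

variable {V : Type*} [AddCommGroup V] [Module ℝ V]

/-! The argument is by contraposition: stability forces the difference of the two indices to be
even. Since `B(z,z) = ω(Lz,z)` with `L` infinitesimally symplectic, Fitting's lemma splits `E₃` into
`ker L^N` and a range on which `L` is invertible, and the two pieces are orthogonal for `ω` and for
`B`. The difference of indices is therefore, up to sign, the negative index of `B` on the range.

On the range the Gram matrix of `B` is the product of the transpose of `L` with the matrix `Ω` of
`ω`. The determinant of `Ω` is positive because `Ω` is skew and nonsingular. If `L` has no nonzero
real eigenvalue, it has no real eigenvalue at all on the range, and its determinant there is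
positive as well. So `B` has positive determinant and an even number of negative squares. Stability
enters only by excluding nonzero real eigenvalues. This is `even_sigNeg_sub_sigNeg_ker`.

To apply it, `E₃` is written as the symplectic complement of `T × MT` for a space `T` of
configurations (`phaseOver`). Positivity of the masses makes this symplectic for every `T`.
Invariance comes from differentiating the translation, scaling and rotation symmetries of `U` at a
central configuration (`hessU_mem_sup`). The exponent only has to be at least `dim E₃ = 8n - 2 dim
T`: here `dim T ≥ 4 + 4` in general, and `dim T ≥ 4 + 6` for planar non-collinear `q`
(`finrank_rotSpan_ge`).

For planar motion of a collinear `q`, stability refers to the simple frame while the index may be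
taken in the double frame. The two spaces `E₃` then coincide, and `L_d = L_s + C` with `C` a
commuting rotation of the normal plane. A nonzero real eigenvalue `μ` of `L_d` thus yields an
eigenvalue `μ` or `μ - ik` of `L_s`, off the imaginary axis. -/

theorem sigNeg_eq_ncard_of_iIsOrtho {ι : Type*} [Fintype ι] (Q : QuadraticForm ℝ V)
    (v : Module.Basis ι ℝ V) (hv : (associated (R := ℝ) Q).IsOrthoᵢ v) :
    _root_.sigNeg Q = {i | Q (v i) < 0}.ncard := by
  apply QuadraticForm.sigNeg_of_equiv_weightedSumSquares
  rw [← basisRepr_eq_of_iIsOrtho Q v hv]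
  exact ⟨Q.isometryEquivBasisRepr v⟩

theorem exists_orthogonal_basis_of_quadraticForm [FiniteDimensional ℝ V]
    (Q : QuadraticForm ℝ V) :
    ∃ v : Module.Basis (Fin (Module.finrank ℝ V)) ℝ V, (associated (R := ℝ) Q).IsOrthoᵢ v :=
  LinearMap.BilinForm.exists_orthogonal_basis
    ⟨fun x y => by simpa using QuadraticMap.associated_isSymm ℝ Q x y⟩

/-- Orthogonal bases of the two pieces concatenate to an orthogonal basis of the whole space, in
which the negative index is a count of basis vectors. -/
theorem sigNeg_eq_add_of_isCompl [FiniteDimensional ℝ V] (Q : QuadraticForm ℝ V)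
    {K W : Submodule ℝ V} (h : IsCompl K W)
    (horth : ∀ x ∈ K, ∀ y ∈ W, associated (R := ℝ) Q x y = 0) :
    _root_.sigNeg Q = _root_.sigNeg (Q.restrict K) + _root_.sigNeg (Q.restrict W) := by
  obtain ⟨v, hv⟩ := exists_orthogonal_basis_of_quadraticForm (Q.restrict K)
  obtain ⟨w, hw⟩ := exists_orthogonal_basis_of_quadraticForm (Q.restrict W)
  let b := (v.prod w).map (K.prodEquivOfIsCompl W h)
  have hbl : ∀ i, b (Sum.inl i) = v i := fun i => by simp [b]
  have hbr : ∀ i, b (Sum.inr i) = w i := fun i => by simp [b]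
  have hb : (associated (R := ℝ) Q).IsOrthoᵢ b := by
    rintro (i | i) (j | j) hij
    · have := hv (i := i) (j := j) (fun h => hij (by rw [h]))
      simpa [Function.onFun, hbl, associated_apply] using this
    · simpa [Function.onFun, hbl, hbr] using horth _ (v i).2 _ (w j).2
    · have := horth _ (v j).2 _ (w i).2
      rw [associated_isSymm ℝ Q] at this
      simpa [Function.onFun, hbl, hbr] using this
    · have := hw (i := i) (j := j) (fun h => hij (by rw [h]))
      simpa [Function.onFun, hbr, associated_apply] using this
  rw [sigNeg_eq_ncard_of_iIsOrtho Q b hb, sigNeg_eq_ncard_of_iIsOrtho _ v hv,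
    sigNeg_eq_ncard_of_iIsOrtho _ w hw]
  simp only [← Nat.card_coe_set_eq]
  rw [← Nat.card_sum]
  refine Nat.card_congr ((Equiv.subtypeSum).trans (Equiv.sumCongr ?_ ?_))
  · exact Equiv.subtypeEquivRight fun i => by simp [hbl]
  · exact Equiv.subtypeEquivRight fun i => by simp [hbr]

theorem even_ncard_neg_of_prod_pos {ι : Type*} [Fintype ι] (w : ι → ℝ) (h : 0 < ∏ i, w i) :
    Even {i | w i < 0}.ncard := by
  classical
  rw [← Finset.prod_filter_mul_prod_filter_not Finset.univ (fun i => w i < 0)] at h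
  have hset : {i | w i < 0} = ((Finset.univ.filter (fun i => w i < 0) : Finset ι) : Set ι) := by
    ext; simp
  rw [hset, Set.ncard_coe_finset]
  by_contra hodd
  rw [Nat.not_even_iff_odd] at hodd
  have h1 : ∏ i ∈ Finset.univ.filter (fun i => w i < 0), w i ≤ 0 := by
    have : ∏ i ∈ Finset.univ.filter (fun i => w i < 0), w i =
        -∏ i ∈ Finset.univ.filter (fun i => w i < 0), -w i := by
      rw [Finset.prod_neg, hodd.neg_one_pow]; ring
    rw [this, neg_nonpos]
    exact Finset.prod_nonneg fun i hi => by
      have := (Finset.mem_filter.1 hi).2; linarith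
  have h2 : 0 ≤ ∏ i ∈ Finset.univ.filter (fun i => ¬ w i < 0), w i :=
    Finset.prod_nonneg fun i hi => not_lt.1 (Finset.mem_filter.1 hi).2
  nlinarith [mul_nonneg (neg_nonneg.2 h1) h2]

end Inertia

/-! ### Real matrices without real eigenvalues -/

/-- On the segment from the identity to `A` the determinant never vanishes: a kernel vector of
`(1-t) + tA` is an eigenvector of `A` for `-(1-t)/t`. It therefore keeps the sign it has at the
identity. -/
theorem Matrix.det_pos_of_no_real_eigenvalue {ι : Type*} [Fintype ι] [DecidableEq ι]
    (A : Matrix ι ι ℝ) (h : ∀ (μ : ℝ) (v : ι → ℝ), A.mulVec v = μ • v → v = 0) : 0 < A.det := by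
  let f : ℝ → ℝ := fun t => ((1 - t) • (1 : Matrix ι ι ℝ) + t • A).det
  have hf : Continuous f := by
    apply Continuous.matrix_det
    fun_prop
  have h0 : f 0 = 1 := by simp [f]
  have h1 : f 1 = A.det := by simp [f]
  have hne : ∀ t, f t ≠ 0 := by
    intro t ht
    obtain ⟨v, hv, hv0⟩ := Matrix.exists_mulVec_eq_zero_iff.2 ht
    rw [Matrix.add_mulVec, Matrix.smul_mulVec, Matrix.smul_mulVec, Matrix.one_mulVec] at hv0
    by_cases ht0 : t = 0
    · subst ht0; simp at hv0; exact hv hv0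
    · refine hv (h (-((1 - t) / t)) v ?_)
      have : t • A.mulVec v = -((1 - t) • v) := eq_neg_of_add_eq_zero_right hv0
      rw [← inv_smul_smul₀ ht0 (A.mulVec v), this, smul_neg, smul_smul, ← neg_smul]
      congr 1; ring
  rw [← h1]
  by_contra hneg
  have : (0 : ℝ) ∈ Set.Icc (f 1) (f 0) := ⟨not_lt.1 hneg, by rw [h0]; exact zero_le_one⟩
  obtain ⟨t, -, ht⟩ := intermediate_value_Icc' zero_le_one hf.continuousOn this
  exact hne t ht

/-- Since `v ⬝ Av = 0`, the only possible real eigenvalue of a skew matrix is `0`, which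
invertibility excludes. This replaces the Pfaffian. -/
theorem Matrix.det_pos_of_transpose_eq_neg {ι : Type*} [Fintype ι] [DecidableEq ι]
    (A : Matrix ι ι ℝ) (hA : A.transpose = -A) (hdet : A.det ≠ 0) : 0 < A.det := by
  refine A.det_pos_of_no_real_eigenvalue fun μ v hv => ?_
  by_contra hv0
  have h1 : v ⬝ᵥ A.mulVec v = 0 := by
    have : v ⬝ᵥ A.mulVec v = -(v ⬝ᵥ A.mulVec v) := by
      conv_lhs => rw [Matrix.dotProduct_mulVec, ← Matrix.mulVec_transpose, hA,
        Matrix.neg_mulVec, neg_dotProduct, dotProduct_comm]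
    linarith
  rw [hv, dotProduct_smul, smul_eq_mul, mul_eq_zero] at h1
  rcases h1 with h1 | h1
  · rw [h1, zero_smul] at hv
    exact hdet (Matrix.exists_mulVec_eq_zero_iff.1 ⟨v, hv0, hv⟩)
  · exact hv0 (dotProduct_self_eq_zero.1 h1)

/-! ### Infinitesimally symplectic maps -/

section Symplectic

open QuadraticMap

variable {V : Type*} [AddCommGroup V] [Module ℝ V]

/-- The quadratic Hamiltonian `z ↦ ω(Az, z)` of a linear map `A`. -/
noncomputable def hamiltonianForm (ω : LinearMap.BilinForm ℝ V) (A : V →ₗ[ℝ] V) : QuadraticForm ℝ V :=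
  LinearMap.BilinMap.toQuadraticMap (ω.compLeft A)

@[simp]
theorem hamiltonianForm_apply (ω : LinearMap.BilinForm ℝ V) (A : V →ₗ[ℝ] V) (z : V) :
    hamiltonianForm ω A z = ω (A z) z := rfl

variable {ω : LinearMap.BilinForm ℝ V} {A : V →ₗ[ℝ] V}

theorem associated_hamiltonianForm (hω : ω.IsAlt) (hA : ∀ x y, ω (A x) y = -ω x (A y)) :
    associated (R := ℝ) (hamiltonianForm ω A) = ω.compLeft A := by
  apply QuadraticMap.associated_left_inverse
  intro x y
  simp only [LinearMap.BilinForm.compLeft_apply]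
  rw [hA x y, hω.neg_eq]

/-- In an orthogonal basis the product of the diagonal values of the form is the determinant of its
Gram matrix, which factors as `det A * det Ω`; both factors are positive. -/
theorem even_sigNeg_hamiltonianForm [FiniteDimensional ℝ V] (hω : ω.IsAlt)
    (hnd : ω.Nondegenerate) (hA : ∀ x y, ω (A x) y = -ω x (A y))
    (h : ∀ (μ : ℝ) (v : V), A v = μ • v → v = 0) :
    Even (_root_.sigNeg (hamiltonianForm ω A)) := by
  classical
  obtain ⟨v, hv⟩ := exists_orthogonal_basis_of_quadraticForm (hamiltonianForm ω A)
  rw [sigNeg_eq_ncard_of_iIsOrtho _ v hv]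
  apply even_ncard_neg_of_prod_pos
  rw [associated_hamiltonianForm hω hA] at hv
  have hdiag : LinearMap.BilinForm.toMatrix v (ω.compLeft A) =
      Matrix.diagonal fun i => hamiltonianForm ω A (v i) := by
    ext i j
    rw [LinearMap.BilinForm.toMatrix_apply]
    by_cases hij : i = j
    · subst hij; simp
    · rw [Matrix.diagonal_apply_ne _ hij]; exact hv hij
  rw [← Matrix.det_diagonal, ← hdiag, LinearMap.BilinForm.toMatrix_compLeft, Matrix.det_mul,
    Matrix.det_transpose]
  refine mul_pos (Matrix.det_pos_of_no_real_eigenvalue _ fun μ x hx => ?_)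
    (Matrix.det_pos_of_transpose_eq_neg _ ?_ ((LinearMap.BilinForm.nondegenerate_iff_det_ne_zero v).1 hnd))
  · have := h μ (v.equivFun.symm x) (by
      apply v.equivFun.injective
      rw [map_smul, LinearEquiv.apply_symm_apply, ← hx]
      ext i
      rw [Module.Basis.equivFun_apply, ← LinearMap.toMatrix_mulVec_repr v v,
        ← Module.Basis.equivFun_apply, LinearEquiv.apply_symm_apply])
    exact (LinearEquiv.map_eq_zero_iff _).1 this
  · ext i j
    simp only [Matrix.transpose_apply, LinearMap.BilinForm.toMatrix_apply, Matrix.neg_apply]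
    exact (hω.neg_eq _ _).symm

theorem pow_skew (hA : ∀ x y, ω (A x) y = -ω x (A y)) (k : ℕ) (x y : V) :
    ω ((A ^ k) x) y = (-1) ^ k * ω x ((A ^ k) y) := by
  induction k generalizing x y with
  | zero => simp
  | succ k ih =>
    rw [pow_succ, Module.End.mul_apply, ih, hA, ← Module.End.mul_apply, ← pow_succ', pow_succ A,
      pow_succ (-1 : ℝ)]
    ring

/-- Fitting decomposition: the kernel of a high power accounts for the first index, so what remains
is the index on the range, where `A` has no real eigenvalue. -/
theorem even_sigNeg_sub_sigNeg_ker [FiniteDimensional ℝ V] (hω : ω.IsAlt)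
    (hnd : ω.Nondegenerate) (hA : ∀ x y, ω (A x) y = -ω x (A y))
    (h : ∀ (μ : ℝ) (v : V), μ ≠ 0 → A v = μ • v → v = 0) {N : ℕ}
    (hN : Module.finrank ℝ V ≤ N) :
    Even ((_root_.sigNeg ((hamiltonianForm ω A).restrict (LinearMap.ker (A ^ N))) : ℤ) -
      _root_.sigNeg (hamiltonianForm ω A)) := by
  obtain ⟨k, hc, hNk⟩ := ((LinearMap.eventually_isCompl_ker_pow_range_pow A).and
    (Filter.eventually_ge_atTop N)).exists
  -- Kernels of powers are stationary from the exponent `dim V` on, so `N` may be exchanged for a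
  -- larger `k` at which kernel and range are complementary.
  have hker : LinearMap.ker (A ^ N) = LinearMap.ker (A ^ k) := by
    rw [Module.End.ker_pow_eq_ker_pow_finrank_of_le hN,
      Module.End.ker_pow_eq_ker_pow_finrank_of_le (hN.trans hNk)]
  rw [hker]
  -- Moving `A ^ k` across `ω` costs only a sign. As the kernel is `A`-invariant, `ω`-orthogonality
  -- also gives orthogonality for the Hamiltonian form.
  have horth : ∀ x ∈ LinearMap.ker (A ^ k), ∀ y ∈ LinearMap.range (A ^ k), ω x y = 0 := by
    rintro x hx _ ⟨y, rfl⟩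
    have := pow_skew hA k x y
    rw [LinearMap.mem_ker.1 hx, map_zero, LinearMap.zero_apply, eq_comm, mul_eq_zero] at this
    exact this.resolve_left (by simp)
  have hcomm : ∀ x, (A ^ k) (A x) = A ((A ^ k) x) := fun x => by
    rw [← Module.End.mul_apply, ← Module.End.mul_apply, ← pow_succ, pow_succ']
  have hAker : ∀ x ∈ LinearMap.ker (A ^ k), A x ∈ LinearMap.ker (A ^ k) := fun x hx => by
    rw [LinearMap.mem_ker, hcomm, LinearMap.mem_ker.1 hx, map_zero]
  have hAran : ∀ x ∈ LinearMap.range (A ^ k), A x ∈ LinearMap.range (A ^ k) := by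
    rintro _ ⟨y, rfl⟩
    exact ⟨A y, hcomm y⟩
  rw [sigNeg_eq_add_of_isCompl _ hc fun x hx y hy => by
    rw [associated_hamiltonianForm hω hA]; exact horth _ (hAker x hx) _ hy]
  let W := LinearMap.range (A ^ k)
  have heven : Even (_root_.sigNeg ((hamiltonianForm ω A).restrict W)) := by
    have : (hamiltonianForm ω A).restrict W =
        hamiltonianForm (ω.restrict W) (A.restrict hAran) := by
      ext x; rfl
    rw [this]
    refine even_sigNeg_hamiltonianForm (fun x => hω x) ?_ (fun x y => hA x y) fun μ v hv => ?_
    · have hr : (ω.restrict W).IsAlt := fun x => hω x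
      have hl : (ω.restrict W).SeparatingLeft := by
        intro x hx
        have : (x : V) = 0 := hnd.1 x fun y => by
          obtain ⟨a, ha, b, hb, rfl⟩ := Submodule.mem_sup.1
            (show y ∈ LinearMap.ker (A ^ k) ⊔ LinearMap.range (A ^ k) by
              rw [hc.sup_eq_top]; trivial)
          rw [map_add, ← hω.neg_eq, horth a ha x x.2, neg_zero, zero_add]
          exact hx ⟨b, hb⟩
        exact Subtype.ext this
      refine ⟨hl, fun y hy => hl y fun x => ?_⟩
      rw [← hr.neg_eq, hy, neg_zero]
    · have hv' : A v = μ • (v : V) := congrArg Subtype.val hv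
      -- The eigenvalue `0` is excluded by the splitting rather than by `h`: such a vector lies in
      -- both kernel and range. If `k = 0`, then `dim V ≤ N ≤ k` forces `V = 0`.
      by_cases hμ : μ = 0
      · rw [hμ, zero_smul] at hv'
        have hk : 0 < k ∨ k = 0 := (Nat.eq_zero_or_pos k).symm
        have hvk : (v : V) ∈ LinearMap.ker (A ^ k) := by
          rcases hk with hk | hk
          · obtain ⟨l, rfl⟩ := Nat.exists_eq_succ_of_ne_zero hk.ne'
            rw [LinearMap.mem_ker, pow_succ, Module.End.mul_apply, hv', map_zero]
          · have : Module.finrank ℝ V = 0 := by omega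
            have := Module.finrank_zero_iff.1 this
            rw [Subsingleton.elim (v : V) 0]; exact zero_mem _
        exact Subtype.ext (Submodule.disjoint_def.1 hc.disjoint _ hvk v.2)
      · exact Subtype.ext (h μ v hμ hv')
  obtain ⟨r, hr⟩ := heven
  refine ⟨-(r : ℤ), ?_⟩
  have : (_root_.sigNeg ((hamiltonianForm ω A).restrict (LinearMap.range (A ^ k))) : ℤ) = r + r := by
    exact_mod_cast hr
  push_cast
  rw [this]; ring

/-- The parity statement on an invariant symplectic subspace. -/
theorem even_sigNeg_sub_sigNeg_ker_of_invariant [FiniteDimensional ℝ V] (hω : ω.IsAlt)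
    (hA : ∀ x y, ω (A x) y = -ω x (A y)) {E : Submodule ℝ V}
    (hE : ∀ x ∈ E, A x ∈ E) (hnd : ∀ x ∈ E, (∀ y ∈ E, ω x y = 0) → x = 0)
    (h : ∀ (μ : ℝ), ∀ v ∈ E, μ ≠ 0 → A v = μ • v → v = 0) {N : ℕ}
    (hN : Module.finrank ℝ E ≤ N) :
    Even ((_root_.sigNeg ((hamiltonianForm ω A).restrict (E ⊓ LinearMap.ker (A ^ N))) : ℤ) -
      _root_.sigNeg ((hamiltonianForm ω A).restrict E)) := by
  have hr : (ω.restrict E).IsAlt := fun x => hω x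
  have hl : (ω.restrict E).SeparatingLeft := fun x hx =>
    Subtype.ext (hnd x x.2 fun y hy => hx ⟨y, hy⟩)
  have key := even_sigNeg_sub_sigNeg_ker (ω := ω.restrict E) (A := A.restrict hE) hr
    ⟨hl, fun y hy => hl y fun x => by rw [← hr.neg_eq, hy, neg_zero]⟩
    (fun x y => hA x y)
    (fun μ v hμ hv => Subtype.ext (h μ v v.2 hμ (congrArg Subtype.val hv))) hN
  have hmem : ∀ x : E, x ∈ LinearMap.ker (A.restrict hE ^ N) ↔ (x : V) ∈ LinearMap.ker (A ^ N) := by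
    intro x
    rw [Module.End.pow_restrict, LinearMap.mem_ker, LinearMap.mem_ker, ← Subtype.coe_inj]
    rfl
  have heq : QuadraticMap.Equivalent
      ((hamiltonianForm (ω.restrict E) (A.restrict hE)).restrict (LinearMap.ker (A.restrict hE ^ N)))
      ((hamiltonianForm ω A).restrict (E ⊓ LinearMap.ker (A ^ N))) := by
    refine ⟨{ toFun := fun x => ⟨x.1.1, x.1.2, (hmem _).1 x.2⟩
              invFun := fun x => ⟨⟨x.1, x.2.1⟩, (hmem _).2 x.2.2⟩
              map_add' := fun x y => rfl
              map_smul' := fun c x => rfl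
              left_inv := fun x => rfl
              right_inv := fun x => rfl
              map_app' := fun x => rfl }⟩
  rw [← heq.sigNeg_eq]
  exact key

end Symplectic

/-! ### The linearized flow on phase space -/

namespace RelEq

variable {n : ℕ}

@[simp]
theorem diagAct_apply (a : E4 →ₗ[ℝ] E4) (x : Config n) (i : Fin n) :
    diagAct a x i = a (x i) := rfl

@[simp]
theorem massOp_apply (m : Fin n → ℝ) (x : Config n) (i : Fin n) :
    massOp m x i = m i • x i := rfl

@[simp]
theorem massInv_apply (m : Fin n → ℝ) (x : Config n) (i : Fin n) :
    massInv m x i = (m i)⁻¹ • x i := rfl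

theorem massInv_massOp {m : Fin n → ℝ} (hm : ∀ i, 0 < m i) (x : Config n) :
    massInv m (massOp m x) = x := by
  ext1 i
  rw [massInv_apply, massOp_apply, inv_smul_smul₀ (hm i).ne']

theorem diagAct_massOp (m : Fin n → ℝ) (a : E4 →ₗ[ℝ] E4) (x : Config n) :
    diagAct a (massOp m x) = massOp m (diagAct a x) := by
  ext1 i
  simp

theorem diagAct_massInv (m : Fin n → ℝ) (a : E4 →ₗ[ℝ] E4) (x : Config n) :
    diagAct a (massInv m x) = massInv m (diagAct a x) := by
  ext1 i
  simp

theorem inner_massOp (m : Fin n → ℝ) (x y : Config n) :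
    inner ℝ (massOp m x) y = ∑ i, m i * inner ℝ (x i) (y i) := by
  rw [PiLp.inner_apply]
  exact Finset.sum_congr rfl fun i _ => by rw [massOp_apply, real_inner_smul_left]

theorem inner_massOp_comm (m : Fin n → ℝ) (x y : Config n) :
    inner ℝ (massOp m x) y = inner ℝ x (massOp m y) := by
  rw [inner_massOp, real_inner_comm, inner_massOp]
  exact Finset.sum_congr rfl fun i _ => by rw [real_inner_comm]

theorem inner_massInv_comm (m : Fin n → ℝ) (x y : Config n) :
    inner ℝ (massInv m x) y = inner ℝ x (massInv m y) :=
  inner_massOp_comm (fun i => (m i)⁻¹) x y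

theorem inner_massOp_self_eq_zero {m : Fin n → ℝ} (hm : ∀ i, 0 < m i) {x : Config n}
    (h : inner ℝ (massOp m x) x = 0) : x = 0 := by
  rw [inner_massOp] at h
  have h0 := (Finset.sum_eq_zero_iff_of_nonneg fun i _ =>
    mul_nonneg (hm i).le real_inner_self_nonneg).1 h
  ext1 i
  exact inner_self_eq_zero.1 ((mul_eq_zero.1 (h0 i (Finset.mem_univ i))).resolve_left (hm i).ne')

theorem massOp_injective {m : Fin n → ℝ} (hm : ∀ i, 0 < m i) :
    Function.Injective (massOp m) :=
  Function.LeftInverse.injective (massInv_massOp hm)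

theorem inner_diagAct_of_skew {a : E4 →ₗ[ℝ] E4} (ha : ∀ x y, inner ℝ (a x) y = -inner ℝ x (a y))
    (x y : Config n) : inner ℝ (diagAct a x) y = -inner ℝ x (diagAct a y) := by
  simp [PiLp.inner_apply, ha]

theorem omega_apply (z w : Phase n) : omega z w = -inner ℝ z.2 w.1 + inner ℝ z.1 w.2 := by
  rw [← inner_neg_left]; rfl

theorem omega_isAlt : (omega (n := n)).IsAlt := fun z => by
  rw [omega_apply, real_inner_comm]; ring

theorem omega_nondegenerate : (omega (n := n)).Nondegenerate := by
  have hl : (omega (n := n)).SeparatingLeft := fun z hz => by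
    have h1 := hz (-z.2, 0)
    have h2 := hz (0, z.1)
    rw [omega_apply] at h1 h2
    simp only [inner_neg_right, neg_neg, inner_zero_right, add_zero, neg_zero, zero_add,
      inner_self_eq_zero] at h1 h2
    exact Prod.ext h2 h1
  refine ⟨hl, fun y hy => hl y fun x => ?_⟩
  rw [← omega_isAlt.neg_eq, hy, neg_zero]

theorem hamL_apply (m : Fin n → ℝ) (q : Config n) (a : E4 →ₗ[ℝ] E4) (z : Phase n) :
    hamL m q a z = (diagAct a z.1 + massInv m z.2, hessU m q z.1 + diagAct a z.2) := rfl

theorem formB_eq_hamiltonianForm (m : Fin n → ℝ) (q : Config n) (a : E4 →ₗ[ℝ] E4) :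
    formB m q a = hamiltonianForm omega (hamL m q a) := rfl

theorem stdJ_comp_matB (m : Fin n → ℝ) (q : Config n) (a : E4 →ₗ[ℝ] E4) :
    stdJ ∘ₗ matB m q a = -hamL m q a := rfl

theorem ker_stdJ_comp_matB_pow (m : Fin n → ℝ) (q : Config n) (a : E4 →ₗ[ℝ] E4) (N : ℕ) :
    LinearMap.ker ((stdJ ∘ₗ matB m q a) ^ N) = LinearMap.ker (hamL m q a ^ N) := by
  have := neg_pow (R := Module.End ℝ (Phase n)) (hamL m q a) N
  rw [stdJ_comp_matB]
  refine (congrArg LinearMap.ker this).trans ?_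
  ext z
  rcases neg_one_pow_eq_or (Module.End ℝ (Phase n)) N with h | h <;> rw [h] <;> simp

theorem omega_hamL {m : Fin n → ℝ} {q : Config n} {a : E4 →ₗ[ℝ] E4}
    (ha : ∀ x y, inner ℝ (a x) y = -inner ℝ x (a y))
    (hH : ∀ x y, inner ℝ (hessU m q x) y = inner ℝ x (hessU m q y)) (z w : Phase n) :
    omega (hamL m q a z) w = -omega z (hamL m q a w) := by
  simp only [omega_apply, hamL_apply, inner_add_left, inner_add_right, hH,
    inner_diagAct_of_skew ha, inner_massInv_comm]
  ring

/-- The phase space over the configurations in `T`, with momenta `M T`. -/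
def phaseOver (m : Fin n → ℝ) (T : Submodule ℝ (Config n)) : Submodule ℝ (Phase n) :=
  T.prod (T.map (massOp m))

theorem phaseOver_sup (m : Fin n → ℝ) (T S : Submodule ℝ (Config n)) :
    phaseOver m T ⊔ phaseOver m S = phaseOver m (T ⊔ S) := by
  rw [phaseOver, phaseOver, phaseOver, Submodule.prod_sup_prod, Submodule.map_sup]

theorem phaseOver_span (m : Fin n → ℝ) (s : Set (Config n)) :
    phaseOver m (Submodule.span ℝ s) =
      Submodule.span ℝ {z | ∃ x ∈ s, z = (x, 0) ∨ z = (0, massOp m x)} := by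
  apply le_antisymm
  · rintro ⟨x, p⟩ ⟨hx, ⟨y, hy, rfl : massOp m y = p⟩⟩
    have h1 : (x, (0 : Config n)) ∈
        Submodule.span ℝ {z : Phase n | ∃ x ∈ s, z = (x, 0) ∨ z = (0, massOp m x)} := by
      have : Submodule.span ℝ s ≤ (Submodule.span ℝ {z : Phase n |
          ∃ x ∈ s, z = (x, 0) ∨ z = (0, massOp m x)}).comap
          (LinearMap.inl ℝ (Config n) (Config n)) :=
        Submodule.span_le.2 fun x hx => Submodule.subset_span ⟨x, hx, Or.inl rfl⟩
      exact this hx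
    have h2 : ((0 : Config n), massOp m y) ∈
        Submodule.span ℝ {z : Phase n | ∃ x ∈ s, z = (x, 0) ∨ z = (0, massOp m x)} := by
      have : Submodule.span ℝ s ≤ (Submodule.span ℝ {z : Phase n |
          ∃ x ∈ s, z = (x, 0) ∨ z = (0, massOp m x)}).comap
          (LinearMap.inr ℝ (Config n) (Config n) ∘ₗ massOp m) :=
        Submodule.span_le.2 fun x hx => Submodule.subset_span ⟨x, hx, Or.inr rfl⟩
      exact this hy
    simpa using Submodule.add_mem _ h1 h2
  · rw [Submodule.span_le]
    rintro z ⟨x, hx, rfl | rfl⟩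
    · exact ⟨Submodule.subset_span hx, Submodule.zero_mem _⟩
    · exact ⟨Submodule.zero_mem _, Submodule.mem_map_of_mem (Submodule.subset_span hx)⟩

theorem finrank_phaseOver {m : Fin n → ℝ} (hm : ∀ i, 0 < m i) (T : Submodule ℝ (Config n)) :
    Module.finrank ℝ (phaseOver m T) = 2 * Module.finrank ℝ T := by
  let e : phaseOver m T ≃ₗ[ℝ] T × T.map (massOp m) :=
    { toFun := fun z => (⟨z.1.1, z.2.1⟩, ⟨z.1.2, z.2.2⟩)
      invFun := fun w => ⟨(w.1.1, w.2.1), w.1.2, w.2.2⟩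
      map_add' := fun z w => rfl
      map_smul' := fun c z => rfl }
  rw [e.finrank_eq, Module.finrank_prod,
    ← (T.equivMapOfInjective _ (massOp_injective hm)).finrank_eq]
  ring

theorem finrank_phase : Module.finrank ℝ (Phase n) = 8 * n := by
  rw [Module.finrank_prod]
  have : Module.finrank ℝ (Config n) = 4 * n := by
    rw [(WithLp.linearEquiv 2 ℝ (Fin n → E4)).finrank_eq, Module.finrank_pi_fintype]
    simp [mul_comm]
  omega

theorem finrank_orthogonal_phaseOver {m : Fin n → ℝ} (hm : ∀ i, 0 < m i)
    (T : Submodule ℝ (Config n)) :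
    Module.finrank ℝ (omega.orthogonal (phaseOver m T)) = 8 * n - 2 * Module.finrank ℝ T := by
  rw [LinearMap.BilinForm.finrank_orthogonal omega_nondegenerate, finrank_phase,
    finrank_phaseOver hm]

/-- Pairing `(x, My)` with `(y, 0)` and `(0, Mx)` produces `⟨My, y⟩` and `⟨Mx, x⟩`. Positivity of
the mass form thus makes `phaseOver m T` symplectic for every `T`. -/
theorem disjoint_phaseOver_orthogonal {m : Fin n → ℝ} (hm : ∀ i, 0 < m i)
    (T : Submodule ℝ (Config n)) :
    Disjoint (phaseOver m T) (omega.orthogonal (phaseOver m T)) := by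
  rw [Submodule.disjoint_def]
  rintro ⟨x, p⟩ ⟨hx, ⟨y, hy, rfl : massOp m y = p⟩⟩ h
  have h1 := h (y, 0) ⟨hy, Submodule.zero_mem _⟩
  have h2 := h (0, massOp m x) ⟨Submodule.zero_mem _, Submodule.mem_map_of_mem hx⟩
  rw [omega_apply] at h1 h2
  simp only [inner_zero_left, neg_zero, zero_add, add_zero, neg_eq_zero] at h1 h2
  rw [← inner_massOp_comm] at h1
  rw [inner_massOp_self_eq_zero hm h1, inner_massOp_self_eq_zero hm h2, map_zero]
  rfl

theorem eq_zero_of_omega_orthogonal {m : Fin n → ℝ} (hm : ∀ i, 0 < m i)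
    (T : Submodule ℝ (Config n)) {z : Phase n} (hz : z ∈ omega.orthogonal (phaseOver m T))
    (h : ∀ w ∈ omega.orthogonal (phaseOver m T), omega z w = 0) : z = 0 := by
  have hc := (LinearMap.BilinForm.isCompl_orthogonal_iff_disjoint omega_isAlt.isRefl).2
    (disjoint_phaseOver_orthogonal hm T)
  refine omega_nondegenerate.1 z fun y => ?_
  obtain ⟨u, hu, w, hw, rfl⟩ := Submodule.mem_sup.1
    (show y ∈ phaseOver m T ⊔ omega.orthogonal (phaseOver m T) by rw [hc.sup_eq_top]; trivial)
  have := hz u hu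
  rw [map_add, h w hw, ← omega_isAlt.neg_eq, this, neg_zero, add_zero]

theorem hamL_mem_phaseOver {m : Fin n → ℝ} (hm : ∀ i, 0 < m i) {q : Config n}
    {a : E4 →ₗ[ℝ] E4} {T : Submodule ℝ (Config n)} (haT : ∀ x ∈ T, diagAct a x ∈ T)
    (hHT : ∀ x ∈ T, hessU m q x ∈ T.map (massOp m)) {z : Phase n} (hz : z ∈ phaseOver m T) :
    hamL m q a z ∈ phaseOver m T := by
  obtain ⟨x, p⟩ := z
  obtain ⟨hx, ⟨y, hy, rfl : massOp m y = p⟩⟩ := hz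
  rw [hamL_apply]
  refine ⟨T.add_mem (haT x hx) ?_, Submodule.add_mem _ (hHT x hx) ?_⟩
  · rw [massInv_massOp hm]; exact hy
  · rw [diagAct_massOp]; exact Submodule.mem_map_of_mem (haT y hy)

theorem mem_orthogonal_of_skew {S : Submodule ℝ (Phase n)} {L : Phase n →ₗ[ℝ] Phase n}
    (hL : ∀ z w, omega (L z) w = -omega z (L w)) (hS : ∀ z ∈ S, L z ∈ S) {z : Phase n}
    (hz : z ∈ omega.orthogonal S) : L z ∈ omega.orthogonal S := by
  intro w hw
  have := hz (L w) (hS w hw)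
  rw [← neg_eq_iff_eq_neg.2 (hL w z), this, neg_zero]

/-- The form in which both frames use the parity statement: all that depends on the frame is a space
`T` stable under the generator and sent by the Hessian into `MT`. The bound on `N` says that `N` is
at least the dimension of the complement. -/
theorem even_indexB3Ker_sub_indexB3 {m : Fin n → ℝ} (hm : ∀ i, 0 < m i) {q : Config n}
    {a : E4 →ₗ[ℝ] E4} {T : Submodule ℝ (Config n)}
    (ha : ∀ x y, inner ℝ (a x) y = -inner ℝ x (a y))
    (hH : ∀ x y, inner ℝ (hessU m q x) y = inner ℝ x (hessU m q y))
    (haT : ∀ x ∈ T, diagAct a x ∈ T) (hHT : ∀ x ∈ T, hessU m q x ∈ T.map (massOp m))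
    (hno : ∀ μ : ℝ, ∀ z ∈ omega.orthogonal (phaseOver m T), μ ≠ 0 → hamL m q a z = μ • z → z = 0)
    {N : ℕ} (hN : 8 * n ≤ N + 2 * Module.finrank ℝ T) :
    Even ((indexB3Ker m q a (omega.orthogonal (phaseOver m T)) N : ℤ) -
      indexB3 m q a (omega.orthogonal (phaseOver m T))) := by
  rw [indexB3Ker, indexB3, ker_stdJ_comp_matB_pow, formB_eq_hamiltonianForm]
  have hskew := omega_hamL (q := q) ha hH
  refine even_sigNeg_sub_sigNeg_ker_of_invariant omega_isAlt hskew
    (fun z hz => mem_orthogonal_of_skew hskew (fun w hw => hamL_mem_phaseOver hm haT hHT hw) hz)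
    (fun z hz h => eq_zero_of_omega_orthogonal hm T hz h) hno ?_
  rw [finrank_orthogonal_phaseOver hm]
  omega

/-- A nonzero real eigenvalue on an invariant subspace contradicts stability. -/
theorem IsStableOn.eq_zero_of_real_eigenvector {L : Phase n →ₗ[ℝ] Phase n}
    {E : Submodule ℝ (Phase n)} (h : IsStableOn L E) {μ : ℝ} {z : Phase n} (hz : z ∈ E)
    (hμ : μ ≠ 0) (hL : L z = μ • z) : z = 0 := by
  by_contra hz0
  refine hμ (Complex.ofReal_re μ ▸ h (μ : ℂ)
    ⟨1 ⊗ₜ z, Submodule.tmul_mem_baseChange_of_mem 1 hz, ?_, ?_⟩)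
  · intro h0
    apply hz0
    -- Taking real parts of the complex coefficients recovers `z` from `1 ⊗ z`.
    have := congrArg ((TensorProduct.lid ℝ (Phase n)) ∘ (Complex.reLm.rTensor (Phase n))) h0
    simpa using this
  · rw [LinearMap.baseChange_tmul, hL, TensorProduct.tmul_smul, TensorProduct.smul_tmul',
      TensorProduct.smul_tmul']
    simp

/-- If `L = L' + C` with `C` commuting with `L'` and `C³ = -k² C`, stability of `L'` excludes
nonzero real eigenvalues of `L`. -/
theorem IsStableOn.eq_zero_of_real_eigenvector_add {L L' C : Phase n →ₗ[ℝ] Phase n}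
    {E : Submodule ℝ (Phase n)} (h : IsStableOn L' E) (hadd : ∀ z, L z = L' z + C z)
    (hcomm : ∀ z, L' (C z) = C (L' z)) (hE : ∀ z ∈ E, C z ∈ E) {k : ℝ} (hk : k ≠ 0)
    (hC : ∀ z, C (C (C z)) = -(k ^ 2) • C z) {μ : ℝ} {z : Phase n} (hz : z ∈ E)
    (hμ : μ ≠ 0) (hL : L z = μ • z) : z = 0 := by
  have hL' : L' z = μ • z - C z := by rw [← hL, hadd]; abel
  by_cases hw : C z = 0
  · refine h.eq_zero_of_real_eigenvector hz hμ ?_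
    rw [hL', hw, sub_zero]
  exfalso
  refine hμ ?_
  have h1 : L' (C z) = μ • C z - C (C z) := by rw [hcomm, hL', map_sub, map_smul]
  have h2 : L' (C (C z)) = μ • C (C z) + (k ^ 2) • C z := by
    rw [hcomm, h1, map_sub, map_smul, hC, neg_smul, sub_neg_eq_add]
  -- With `w = Cz`, the relations `L'w = μw - Cw` and `L'(Cw) = μCw + k²w` make `Cw + ik w` an
  -- eigenvector for `μ - ik`. It is nonzero because its imaginary part is `k w`.
  have := h (μ - k * Complex.I)
    ⟨1 ⊗ₜ C (C z) + (k * Complex.I) ⊗ₜ C z,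
      Submodule.add_mem _ (Submodule.tmul_mem_baseChange_of_mem 1 (hE _ (hE _ hz)))
        (Submodule.tmul_mem_baseChange_of_mem _ (hE _ hz)), ?_, ?_⟩
  · simpa using this
  · intro h0
    have := congrArg ((TensorProduct.lid ℝ (Phase n)) ∘ (Complex.imLm.rTensor (Phase n))) h0
    simp at this
    tauto
  · rw [map_add, LinearMap.baseChange_tmul, LinearMap.baseChange_tmul, h1, h2]
    simp only [TensorProduct.tmul_add, TensorProduct.tmul_sub, TensorProduct.tmul_smul,
      smul_add, TensorProduct.smul_tmul', smul_eq_mul]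
    have e1 : ∀ (r : ℝ) (c : ℂ), r • c = (r : ℂ) * c := fun r c => Complex.real_smul
    simp only [e1]
    have e2 : ((μ : ℂ) - k * Complex.I) * (k * Complex.I) = (k ^ 2 : ℂ) + μ * (k * Complex.I) := by
      linear_combination (-(k : ℂ) ^ 2) * Complex.I_sq
    rw [e2, sub_mul, TensorProduct.add_tmul, TensorProduct.sub_tmul]
    push_cast
    simp only [mul_one]
    abel

end RelEq

/-! ### Second derivatives in terms of the gradient -/

section Gradient

variable {F : Type*} [NormedAddCommGroup F] [InnerProductSpace ℝ F] [CompleteSpace F]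

theorem differentiableAt_gradient_of_contDiffAt {U : F → ℝ} {x : F} (h : ContDiffAt ℝ 2 U x) :
    DifferentiableAt ℝ (gradient U) x :=
  (InnerProductSpace.toDual ℝ F).symm.toContinuousLinearEquiv.differentiableAt.comp x
    ((h.fderiv_right (m := 1) (by norm_num)).differentiableAt one_ne_zero)

theorem inner_fderiv_gradient {U : F → ℝ} {q : F} (h : ContDiffAt ℝ 2 U q) (x y : F) :
    inner ℝ (fderiv ℝ (gradient U) q x) y = fderiv ℝ (fderiv ℝ U) q x y := by
  have h1 : DifferentiableAt ℝ (fderiv ℝ U) q :=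
    (h.fderiv_right (m := 1) (by norm_num)).differentiableAt one_ne_zero
  have h2 := (InnerProductSpace.toDual ℝ F).symm.toContinuousLinearEquiv.hasFDerivAt.comp
    q h1.hasFDerivAt
  have h3 : fderiv ℝ (gradient U) q = _ := h2.fderiv
  rw [h3]
  exact InnerProductSpace.toDual_symm_apply

theorem inner_fderiv_gradient_comm {U : F → ℝ} {q : F} (h : ContDiffAt ℝ 2 U q)
    (x y : F) :
    inner ℝ (fderiv ℝ (gradient U) q x) y = inner ℝ x (fderiv ℝ (gradient U) q y) := by
  rw [inner_fderiv_gradient h, real_inner_comm, inner_fderiv_gradient h]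
  exact h.isSymmSndFDerivAt (by simp) x y

/-- Differentiating the identity `⟨∇U(x), B x⟩ = c U(x)`. -/
theorem inner_fderiv_gradient_of_eventually {U : F → ℝ} {q : F}
    (hU : ContDiffAt ℝ 2 U q) {B : F → F} {B' : F →L[ℝ] F} (hB : HasFDerivAt B B' q) (c : ℝ)
    (h : ∀ᶠ x in nhds q, fderiv ℝ U x (B x) = c * U x) (y : F) :
    inner ℝ (fderiv ℝ (gradient U) q (B q)) y =
      c * inner ℝ (gradient U q) y - inner ℝ (gradient U q) (B' y) := by
  have h1 := (differentiableAt_gradient_of_contDiffAt hU).hasFDerivAt.inner ℝ hB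
  have h2 : HasFDerivAt (fun x => c * U x) (c • fderiv ℝ U q) q :=
    (hU.differentiableAt two_ne_zero).hasFDerivAt.const_mul c
  have h3 : (fun x => inner ℝ (gradient U x) (B x)) =ᶠ[nhds q] fun x => c * U x := by
    filter_upwards [h] with x hx
    rw [inner_gradient_left, hx]
  have h4 := congrArg (fun f => f y) (h1.unique (h2.congr_of_eventuallyEq h3))
  simp only [ContinuousLinearMap.comp_apply, ContinuousLinearMap.prod_apply, fderivInnerCLM_apply,
    smul_apply, smul_eq_mul] at h4
  rw [← inner_gradient_left] at h4
  rw [inner_fderiv_gradient_comm hU, real_inner_comm, ← h4]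
  ring

theorem inner_fderiv_gradient_of_linear [FiniteDimensional ℝ F] {U : F → ℝ} {q : F}
    (hU : ContDiffAt ℝ 2 U q) (B : F →ₗ[ℝ] F) (h : ∀ᶠ x in nhds q, fderiv ℝ U x (B x) = 0)
    (y : F) :
    inner ℝ (fderiv ℝ (gradient U) q (B q)) y = -inner ℝ (gradient U q) (B y) := by
  have := inner_fderiv_gradient_of_eventually hU
    (LinearMap.toContinuousLinearMap B).hasFDerivAt 0 (by simpa using h) y
  simpa using this

/-- The Hessian at a fixed point of a linear isometry that preserves `U` commutes with it. -/
theorem fderiv_gradient_isometry {U : F → ℝ} {q : F} (G : F ≃ₗᵢ[ℝ] F) (hU : U ∘ G = U)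
    (hGq : G q = q) (x : F) :
    fderiv ℝ (gradient U) q (G x) = G (fderiv ℝ (gradient U) q x) := by
  have hgrad : gradient U ∘ G = G ∘ gradient U := by
    ext1 x
    refine ext_inner_right ℝ fun y => ?_
    obtain ⟨y, rfl⟩ := G.surjective y
    rw [Function.comp_apply, Function.comp_apply, LinearIsometryEquiv.inner_map_map,
      inner_gradient_left, inner_gradient_left]
    have := G.toContinuousLinearEquiv.comp_right_fderiv (f := U) (x := x)
    have h2 := congrArg (fun f => f y) this
    simpa [hU] using h2.symm
  have h1 := G.toContinuousLinearEquiv.comp_right_fderiv (f := gradient U) (x := q)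
  have h2 := G.toContinuousLinearEquiv.comp_fderiv (f := gradient U) (x := q)
  have h3 : fderiv ℝ (gradient U ∘ G) q = fderiv ℝ (G ∘ gradient U) q := by
    rw [hgrad]
  have h4 := congrArg (fun f => f x) ((h1.symm.trans h3).trans h2)
  simp only [ContinuousLinearMap.comp_apply] at h4
  change fderiv ℝ (gradient U) (G q) (G x) = G (fderiv ℝ (gradient U) q x) at h4
  rwa [hGq] at h4

end Gradient

/-! ### Derivatives of the Newtonian potential -/

namespace RelEq

variable {n : ℕ}

theorem contDiffAt_potential (m : Fin n → ℝ) {x : Config n} (hx : ∀ i j, i ≠ j → x i ≠ x j)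
    (k : WithTop ℕ∞) : ContDiffAt ℝ k (potential m) x := by
  unfold potential
  refine ContDiffAt.sum fun i _ => ContDiffAt.sum fun j hj => ?_
  have hij : x i - x j ≠ 0 := sub_ne_zero.2 (hx i j (Finset.mem_Ioi.1 hj).ne)
  have hd : ContDiffAt ℝ k (fun x : Config n => x i - x j) x := by fun_prop
  exact contDiffAt_const.div (hd.norm ℝ hij) (norm_ne_zero_iff.2 hij)

theorem hasDerivAt_inv_norm {d d' : E4} (hd : d ≠ 0) (c : ℝ) :
    HasDerivAt (fun t : ℝ => c / ‖d + t • d'‖) (-(c * inner ℝ d d' / ‖d‖ ^ 3)) 0 := by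
  have h1 : HasDerivAt (fun t : ℝ => d + t • d') d' 0 := by
    simpa using ((hasDerivAt_id (0 : ℝ)).smul_const d').const_add d
  have h2 := h1.norm_sq.sqrt (by simpa using hd)
  simp only [Real.sqrt_sq (norm_nonneg _), zero_smul, add_zero] at h2
  have h3 := (hasDerivAt_const (0 : ℝ) c).div h2 (by simpa using hd)
  simp only [zero_smul, add_zero] at h3
  have hn : ‖d‖ ≠ 0 := norm_ne_zero_iff.2 hd
  convert! h3 using 1
  field_simp
  ring

theorem fderiv_potential (m : Fin n → ℝ) {x : Config n} (hx : ∀ i j, i ≠ j → x i ≠ x j)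
    (y : Config n) : fderiv ℝ (potential m) x y =
      ∑ i, ∑ j ∈ Finset.Ioi i,
        -(m i * m j * inner ℝ (x i - x j) (y i - y j) / ‖x i - x j‖ ^ 3) := by
  have h := ((contDiffAt_potential m hx 1).differentiableAt one_ne_zero).hasFDerivAt.hasLineDerivAt y
  refine HasDerivAt.unique h ?_
  unfold potential
  refine HasDerivAt.fun_sum fun i _ => HasDerivAt.fun_sum fun j hj => ?_
  have hij : x i - x j ≠ 0 := sub_ne_zero.2 (hx i j (Finset.mem_Ioi.1 hj).ne)
  convert! hasDerivAt_inv_norm (d' := y i - y j) hij (m i * m j) using 3 with t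
  congr 1
  simp only [PiLp.add_apply, PiLp.smul_apply, smul_sub]
  abel

theorem eventually_collisionFree {q : Config n} (hq : ∀ i j, i ≠ j → q i ≠ q j) :
    ∀ᶠ x in nhds q, ∀ i j, i ≠ j → x i ≠ x j := by
  rw [Filter.eventually_all]
  intro i
  rw [Filter.eventually_all]
  intro j
  by_cases hij : i = j
  · simp [hij]
  · have hi : ContinuousAt (fun x : Config n => x i) q := by fun_prop
    have hj : ContinuousAt (fun x : Config n => x j) q := by fun_prop
    filter_upwards [(hi.sub hj).eventually_ne (sub_ne_zero.2 (hq i j hij))] with x hx _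
      using sub_ne_zero.1 hx

theorem hessU_symm (m : Fin n → ℝ) {q : Config n} (hq : ∀ i j, i ≠ j → q i ≠ q j)
    (x y : Config n) : inner ℝ (hessU m q x) y = inner ℝ x (hessU m q y) :=
  inner_fderiv_gradient_comm (contDiffAt_potential m hq 2) x y

theorem inner_hessU_of_identity (m : Fin n → ℝ) {q : Config n}
    (hq : ∀ i j, i ≠ j → q i ≠ q j) {B : Config n → Config n} {B' : Config n →L[ℝ] Config n}
    (hB : HasFDerivAt B B' q) (c : ℝ)
    (h : ∀ x : Config n, (∀ i j, i ≠ j → x i ≠ x j) →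
      fderiv ℝ (potential m) x (B x) = c * potential m x) (y : Config n) :
    inner ℝ (hessU m q (B q)) y =
      c * inner ℝ (gradient (potential m) q) y - inner ℝ (gradient (potential m) q) (B' y) :=
  inner_fderiv_gradient_of_eventually (contDiffAt_potential m hq 2) hB c
    ((eventually_collisionFree hq).mono h) y

/-- Translation invariance: `⟨∇U(x), (v, …, v)⟩ = 0` differentiated along a constant field. -/
theorem hessU_diagonal (m : Fin n → ℝ) {q : Config n} (hq : ∀ i j, i ≠ j → q i ≠ q j) (v : E4) :
    hessU m q (WithLp.toLp 2 fun _ => v) = 0 := by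
  refine ext_inner_right ℝ fun y => ?_
  rw [inner_hessU_of_identity m hq
    (hasFDerivAt_const (WithLp.toLp 2 fun _ => v : Config n) q) 0 fun x hx => by
      simp [fderiv_potential m hx]]
  simp

theorem potential_homogeneous (m : Fin n → ℝ) {x : Config n} (hx : ∀ i j, i ≠ j → x i ≠ x j) :
    fderiv ℝ (potential m) x x = -1 * potential m x := by
  rw [fderiv_potential m hx, potential, Finset.mul_sum]
  refine Finset.sum_congr rfl fun i _ => ?_
  rw [Finset.mul_sum]
  refine Finset.sum_congr rfl fun j hj => ?_
  have hij : ‖x i - x j‖ ≠ 0 :=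
    norm_ne_zero_iff.2 (sub_ne_zero.2 (hx i j (Finset.mem_Ioi.1 hj).ne))
  rw [real_inner_self_eq_norm_sq]
  field_simp

/-- Euler's relation differentiated once: `∇U` is homogeneous of degree `-2`. -/
theorem hessU_self (m : Fin n → ℝ) {q : Config n} (hq : ∀ i j, i ≠ j → q i ≠ q j) :
    hessU m q q = (-2 : ℝ) • gradient (potential m) q := by
  refine ext_inner_right ℝ fun y => ?_
  have := inner_hessU_of_identity m hq (hasFDerivAt_id q) (-1)
    (fun x hx => potential_homogeneous m hx) y
  simp only [id, ContinuousLinearMap.id_apply] at this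
  rw [this, real_inner_smul_left]
  ring

theorem inner_skew_self {a : E4 →ₗ[ℝ] E4} (ha : ∀ x y, inner ℝ (a x) y = -inner ℝ x (a y))
    (x : E4) : inner ℝ x (a x) = 0 := by
  have := ha x x
  rw [real_inner_comm] at this
  linarith

/-- Rotation invariance: `⟨∇U(x), ax⟩ = 0` for skew `a`, differentiated at `q`. -/
theorem hessU_skew (m : Fin n → ℝ) {q : Config n} (hq : ∀ i j, i ≠ j → q i ≠ q j)
    {a : E4 →ₗ[ℝ] E4} (ha : ∀ x y, inner ℝ (a x) y = -inner ℝ x (a y)) :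
    hessU m q (diagAct a q) = diagAct a (gradient (potential m) q) := by
  refine ext_inner_right ℝ fun y => ?_
  have := inner_fderiv_gradient_of_linear (contDiffAt_potential m hq 2) (diagAct a)
    ((eventually_collisionFree hq).mono fun x hx => by
      rw [fderiv_potential m hx]
      refine Finset.sum_eq_zero fun i _ => Finset.sum_eq_zero fun j _ => ?_
      rw [diagAct_apply, diagAct_apply, ← map_sub, inner_skew_self ha]
      simp) y
  rw [inner_diagAct_of_skew ha, ← this]
  rfl

/-- The Hessian at `q` commutes with the linear isometries that fix `q`. -/
theorem hessU_diagAct_isometry (m : Fin n → ℝ) {q : Config n} (R : E4 ≃ₗᵢ[ℝ] E4)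
    (hR : ∀ i, R (q i) = q i) (x : Config n) :
    hessU m q (diagAct R.toLinearEquiv.toLinearMap x) =
      diagAct R.toLinearEquiv.toLinearMap (hessU m q x) := by
  let G : Config n ≃ₗᵢ[ℝ] Config n := LinearIsometryEquiv.piLpCongrRight 2 fun _ => R
  have hG : ∀ x, G x = diagAct R.toLinearEquiv.toLinearMap x := fun x => rfl
  have hU : potential m ∘ G = potential m := by
    ext x
    simp only [Function.comp, potential, hG, diagAct_apply, LinearEquiv.coe_coe,
      LinearIsometryEquiv.coe_toLinearEquiv]
    simp_rw [← map_sub, LinearIsometryEquiv.norm_map]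
  exact fderiv_gradient_isometry G hU (by ext1 i; exact hR i) x

end RelEq

/-! ### Quaternion frames and infinitesimal rotations of `ℝ⁴` -/

namespace RelEq

variable {n : ℕ}

theorem inner_toEuclideanLin_of_skew {A : Matrix (Fin 4) (Fin 4) ℝ} (hA : A.transpose = -A)
    (x y : E4) :
    inner ℝ (Matrix.toEuclideanLin A x) y = -inner ℝ x (Matrix.toEuclideanLin A y) := by
  have h : ∀ i j, A j i = -A i j := fun i j => by
    have := congrFun (congrFun hA i) j
    simpa using this
  have h0 : ∀ i, A i i = 0 := fun i => by linarith [h i i]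
  simp only [PiLp.inner_apply, Fin.sum_univ_four, Matrix.toLpLin_apply, Matrix.mulVec, dotProduct,
    RCLike.inner_apply, conj_trivial, h0]
  rw [h 0 1, h 0 2, h 0 3, h 1 2, h 1 3, h 2 3]
  ring

theorem transpose_quatI : quatI.transpose = -quatI := by
  ext i j; fin_cases i <;> fin_cases j <;> simp [quatI]

theorem transpose_quatJ : quatJ.transpose = -quatJ := by
  ext i j; fin_cases i <;> fin_cases j <;> simp [quatJ]

theorem transpose_quatK : quatK.transpose = -quatK := by
  ext i j; fin_cases i <;> fin_cases j <;> simp [quatK]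

theorem transpose_genRot (l r : Fin 4) : (genRot l r).transpose = -genRot l r := by
  simp [genRot, Matrix.transpose_sub, Matrix.transpose_single]

theorem quatI_mul_quatI : quatI * quatI = -1 := by
  ext i j; fin_cases i <;> fin_cases j <;> simp [quatI, Matrix.mul_apply, Fin.sum_univ_four]

theorem quatI_mul_quatJ : quatI * quatJ = quatK := by
  ext i j
  fin_cases i <;> fin_cases j <;>
    simp [quatI, quatJ, quatK, Matrix.mul_apply, Fin.sum_univ_four]

theorem quatI_mul_quatK : quatI * quatK = -quatJ := by
  rw [← quatI_mul_quatJ, ← mul_assoc, quatI_mul_quatI, neg_one_mul]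

/-- Left multiplication by the quaternion unit `i`. -/
noncomputable def opI : E4 →ₗ[ℝ] E4 := Matrix.toEuclideanLin quatI

theorem opI_skew (x y : E4) : inner ℝ (opI x) y = -inner ℝ x (opI y) :=
  inner_toEuclideanLin_of_skew transpose_quatI x y

theorem toEuclideanLin_mul_apply (A B : Matrix (Fin 4) (Fin 4) ℝ) (x : E4) :
    Matrix.toEuclideanLin A (Matrix.toEuclideanLin B x) = Matrix.toEuclideanLin (A * B) x := by
  simp

theorem toEuclideanLin_one_apply (x : E4) :
    Matrix.toEuclideanLin (1 : Matrix (Fin 4) (Fin 4) ℝ) x = x := by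
  simp

theorem opI_opI (x : E4) : opI (opI x) = -x := by
  rw [opI, toEuclideanLin_mul_apply, quatI_mul_quatI, map_neg, LinearMap.neg_apply,
    toEuclideanLin_one_apply]

theorem norm_opI (x : E4) : ‖opI x‖ = ‖x‖ := by
  have : inner ℝ (opI x) (opI x) = inner ℝ x x := by
    rw [opI_skew, opI_opI, inner_neg_right, neg_neg]
  rw [real_inner_self_eq_norm_sq, real_inner_self_eq_norm_sq] at this
  exact (sq_eq_sq₀ (norm_nonneg _) (norm_nonneg _)).1 this

/-- The quaternion multiples of a vector form an orthogonal frame. -/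
theorem quaternion_frame (e y : E4) :
    (‖e‖ ^ 2) • y = inner ℝ e y • e +
      inner ℝ (Matrix.toEuclideanLin quatI e) y • Matrix.toEuclideanLin quatI e +
      inner ℝ (Matrix.toEuclideanLin quatJ e) y • Matrix.toEuclideanLin quatJ e +
      inner ℝ (Matrix.toEuclideanLin quatK e) y • Matrix.toEuclideanLin quatK e := by
  rw [EuclideanSpace.real_norm_sq_eq, Fin.sum_univ_four]
  ext i
  fin_cases i <;>
  · simp [PiLp.inner_apply, Fin.sum_univ_four, Matrix.toLpLin_apply, dotProduct,
      quatI, quatJ, quatK]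
    ring

/-- Skew-symmetric operators are combinations of the coordinate rotations. -/
theorem skew_apply_mem_span {a : E4 →ₗ[ℝ] E4} (ha : ∀ x y, inner ℝ (a x) y = -inner ℝ x (a y)) :
    a ∈ Submodule.span ℝ {b | ∃ l r : Fin 4, l < r ∧ b = Matrix.toEuclideanLin (genRot l r)} := by
  obtain ⟨A, rfl⟩ := Matrix.toEuclideanLin.surjective a
  have h : ∀ i j, A j i = -A i j := fun i j => by
    have := ha (EuclideanSpace.single i 1) (EuclideanSpace.single j 1)
    simpa [Matrix.toLpLin_apply, Matrix.mulVec, dotProduct, PiLp.inner_apply, Pi.single_apply]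
      using this
  have h0 : ∀ i, A i i = 0 := fun i => by linarith [h i i]
  have hA : A = A 1 0 • genRot 0 1 + A 2 0 • genRot 0 2 + A 3 0 • genRot 0 3 +
      A 2 1 • genRot 1 2 + A 3 1 • genRot 1 3 + A 3 2 • genRot 2 3 := by
    ext i j
    fin_cases i <;> fin_cases j <;> simp [genRot, h0, h 1 0, h 2 0, h 3 0,
      h 2 1, h 3 1, h 3 2]
  have hm : ∀ (c : ℝ) (l r : Fin 4), l < r → c • Matrix.toEuclideanLin (genRot l r) ∈
      Submodule.span ℝ {b | ∃ l r : Fin 4, l < r ∧ b = Matrix.toEuclideanLin (genRot l r)} :=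
    fun c l r hlr => Submodule.smul_mem _ c (Submodule.subset_span ⟨l, r, hlr, rfl⟩)
  rw [hA]
  simp only [map_add, map_smul]
  refine Submodule.add_mem _ (Submodule.add_mem _ (Submodule.add_mem _ (Submodule.add_mem _
    (Submodule.add_mem _ ?_ ?_) ?_) ?_) ?_) ?_ <;> exact hm _ _ _ (by decide)

/-! ### The configuration spaces underlying the invariant subspaces -/

/-- The constant configurations. -/
noncomputable def constConfig : E4 →ₗ[ℝ] Config n where
  toFun v := WithLp.toLp 2 fun _ => v
  map_add' _ _ := rfl
  map_smul' _ _ := rfl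

@[simp]
theorem constConfig_apply (v : E4) (i : Fin n) : constConfig v i = v := rfl

/-- The quaternion multiples of `q`. -/
noncomputable def quatSpan (q : Config n) : Submodule ℝ (Config n) :=
  Submodule.span ℝ {x | ∃ a ∈ ({1, quatI, quatJ, quatK} : Set (Matrix (Fin 4) (Fin 4) ℝ)),
    x = diagAct (Matrix.toEuclideanLin a) q}

/-- The tangent space of the orbit of `q` under similarities. -/
noncomputable def rotSpan (q : Config n) : Submodule ℝ (Config n) :=
  Submodule.span ℝ ({q} ∪ {x | ∃ l r : Fin 4, l < r ∧
    x = diagAct (Matrix.toEuclideanLin (genRot l r)) q})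

theorem E1_eq (m : Fin n → ℝ) : E1 m = phaseOver m (LinearMap.range constConfig) := by
  apply le_antisymm
  · refine Submodule.span_le.2 ?_
    rintro _ ⟨v, w, rfl⟩
    exact ⟨⟨v, rfl⟩, ⟨constConfig w, ⟨w, rfl⟩, rfl⟩⟩
  · rintro ⟨x, p⟩ ⟨⟨v, rfl : constConfig v = x⟩, ⟨_, ⟨w, rfl⟩, rfl : massOp m _ = p⟩⟩
    exact Submodule.subset_span ⟨v, w, rfl⟩

theorem E2d_eq (m : Fin n → ℝ) (q : Config n) : E2d m q = phaseOver m (quatSpan q) := by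
  rw [quatSpan, phaseOver_span, E2d]
  congr 1
  ext z
  constructor
  · rintro ⟨a, ha, h⟩
    exact ⟨_, ⟨a, ha, rfl⟩, by rwa [← diagAct_massOp]⟩
  · rintro ⟨_, ⟨a, ha, rfl⟩, h⟩
    exact ⟨a, ha, by rwa [diagAct_massOp]⟩

theorem E2s_eq (m : Fin n → ℝ) (q : Config n) : E2s m q = phaseOver m (rotSpan q) := by
  rw [rotSpan, phaseOver_span, E2s]
  congr 1
  ext z
  constructor
  · rintro ((rfl | rfl) | ⟨l, r, hlr, h⟩)
    · exact ⟨q, Or.inl rfl, Or.inl rfl⟩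
    · exact ⟨q, Or.inl rfl, Or.inr rfl⟩
    · exact ⟨_, Or.inr ⟨l, r, hlr, rfl⟩, h⟩
  · rintro ⟨_, rfl | ⟨l, r, hlr, rfl⟩, h⟩
    · rcases h with rfl | rfl
      · exact Or.inl (Or.inl rfl)
      · exact Or.inl (Or.inr rfl)
    · exact Or.inr ⟨l, r, hlr, h⟩

theorem E3d_eq (m : Fin n → ℝ) (q : Config n) :
    E3d m q = omega.orthogonal (phaseOver m (LinearMap.range constConfig ⊔ quatSpan q)) := by
  rw [E3d, E1_eq, E2d_eq, phaseOver_sup]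

theorem E3s_eq (m : Fin n → ℝ) (q : Config n) :
    E3s m q = omega.orthogonal (phaseOver m (LinearMap.range constConfig ⊔ rotSpan q)) := by
  rw [E3s, E1_eq, E2s_eq, phaseOver_sup]

theorem diagAct_smul_apply (c : ℝ) (a : E4 →ₗ[ℝ] E4) (x : Config n) :
    diagAct (c • a) x = c • diagAct a x := rfl

/-- The evaluation `a ↦ diagAct a q`, as a linear map. -/
noncomputable def diagActAt (q : Config n) : (E4 →ₗ[ℝ] E4) →ₗ[ℝ] Config n where
  toFun a := diagAct a q
  map_add' _ _ := rfl
  map_smul' _ _ := rfl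

theorem self_mem_rotSpan (q : Config n) : q ∈ rotSpan q := Submodule.subset_span (Or.inl rfl)

theorem diagAct_mem_rotSpan {a : E4 →ₗ[ℝ] E4} (ha : ∀ x y, inner ℝ (a x) y = -inner ℝ x (a y))
    (q : Config n) : diagAct a q ∈ rotSpan q := by
  have h : Submodule.span ℝ {b | ∃ l r : Fin 4, l < r ∧
      b = Matrix.toEuclideanLin (genRot l r)} ≤ (rotSpan q).comap (diagActAt q) := by
    refine Submodule.span_le.2 ?_
    rintro _ ⟨l, r, hlr, rfl⟩
    exact Submodule.subset_span (Or.inr ⟨l, r, hlr, rfl⟩)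
  exact h (skew_apply_mem_span ha)

theorem diagAct_mem_quatSpan {a : Matrix (Fin 4) (Fin 4) ℝ}
    (ha : a ∈ ({1, quatI, quatJ, quatK} : Set (Matrix (Fin 4) (Fin 4) ℝ))) (q : Config n) :
    diagAct (Matrix.toEuclideanLin a) q ∈ quatSpan q :=
  Submodule.subset_span ⟨a, ha, rfl⟩

theorem diagAct_one_apply (q : Config n) :
    diagAct (Matrix.toEuclideanLin (1 : Matrix (Fin 4) (Fin 4) ℝ)) q = q := by
  ext1 i
  exact toEuclideanLin_one_apply _

theorem self_mem_quatSpan (q : Config n) : q ∈ quatSpan q := by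
  have := diagAct_mem_quatSpan (a := 1) (by simp) q
  rwa [diagAct_one_apply] at this

/-- A quaternion unit is `1` or skew-symmetric. -/
theorem eq_one_or_skew {a : Matrix (Fin 4) (Fin 4) ℝ}
    (ha : a ∈ ({1, quatI, quatJ, quatK} : Set (Matrix (Fin 4) (Fin 4) ℝ))) :
    a = 1 ∨ a.transpose = -a := by
  rcases ha with rfl | rfl | rfl | rfl
  · exact Or.inl rfl
  · exact Or.inr transpose_quatI
  · exact Or.inr transpose_quatJ
  · exact Or.inr transpose_quatK

theorem quatSpan_le_rotSpan (q : Config n) : quatSpan q ≤ rotSpan q := by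
  refine Submodule.span_le.2 ?_
  rintro _ ⟨a, ha, rfl⟩
  rcases eq_one_or_skew ha with rfl | h
  · rw [diagAct_one_apply]; exact self_mem_rotSpan q
  · exact diagAct_mem_rotSpan (inner_toEuclideanLin_of_skew h) q

theorem diagAct_constConfig (a : E4 →ₗ[ℝ] E4) {x : Config n}
    (hx : x ∈ LinearMap.range (constConfig (n := n))) :
    diagAct a x ∈ LinearMap.range (constConfig (n := n)) := by
  obtain ⟨v, rfl⟩ := hx
  exact ⟨a v, rfl⟩

theorem diagAct_mem_sup (a : E4 →ₗ[ℝ] E4) {S : Submodule ℝ (Config n)}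
    (hS : ∀ x ∈ S, diagAct a x ∈ S) :
    ∀ x ∈ LinearMap.range constConfig ⊔ S, diagAct a x ∈ LinearMap.range constConfig ⊔ S := by
  intro x hx
  obtain ⟨y, hy, z, hz, rfl⟩ := Submodule.mem_sup.1 hx
  rw [map_add]
  exact Submodule.add_mem_sup (diagAct_constConfig a hy) (hS z hz)

theorem diagAct_opI_mem_quatSpan (c : ℝ) (q : Config n) :
    ∀ x ∈ quatSpan q, diagAct (c • opI) x ∈ quatSpan q := by
  intro x hx
  rw [diagAct_smul_apply]
  refine Submodule.smul_mem _ c ?_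
  have h : quatSpan q ≤ (quatSpan q).comap (diagAct opI) := by
    refine Submodule.span_le.2 ?_
    rintro _ ⟨a, ha, rfl⟩
    have key : diagAct opI (diagAct (Matrix.toEuclideanLin a) q) =
        diagAct (Matrix.toEuclideanLin (quatI * a)) q := by
      ext1 i
      exact toEuclideanLin_mul_apply _ _ _
    show diagAct opI _ ∈ quatSpan q
    rw [key]
    have hneg : ∀ b : Matrix (Fin 4) (Fin 4) ℝ, diagAct (Matrix.toEuclideanLin (-b)) q =
        -diagAct (Matrix.toEuclideanLin b) q := fun b => by
      rw [map_neg]; rfl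
    rcases ha with rfl | rfl | rfl | rfl
    · rw [mul_one]; exact diagAct_mem_quatSpan (by simp) q
    · rw [quatI_mul_quatI, hneg]; exact neg_mem (diagAct_mem_quatSpan (by simp) q)
    · rw [quatI_mul_quatJ]; exact diagAct_mem_quatSpan (by simp) q
    · rw [quatI_mul_quatK, hneg]; exact neg_mem (diagAct_mem_quatSpan (by simp) q)
  exact h hx

/-! ### The Hessian at a central configuration -/

theorem IsCentralConfiguration.gradient_eq {m : Fin n → ℝ} {q : Config n}
    (hq : IsCentralConfiguration m q) :
    ∃ c : ℝ, gradient (potential m) q = massOp m (c • q) :=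
  ⟨-(potential m q / inertia m q), by
    rw [map_smul, neg_smul]; exact eq_neg_of_add_eq_zero_left hq.balance⟩

/-- Translations are killed by the Hessian. Scaling and rotations send it to multiples of `∇U` and
`a∇U`, and at a central configuration `∇U` is a multiple of `Mq`, so the values lie in `M` times the
same space. -/
theorem hessU_mem_sup {m : Fin n → ℝ} {q : Config n} (hq : IsCentralConfiguration m q)
    {s : Set (Config n)} (hs : ∀ x ∈ s, x = q ∨ ∃ a : E4 →ₗ[ℝ] E4,
      (∀ x y, inner ℝ (a x) y = -inner ℝ x (a y)) ∧ x = diagAct a q) :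
    ∀ x ∈ LinearMap.range constConfig ⊔ Submodule.span ℝ s,
      hessU m q x ∈ (LinearMap.range constConfig ⊔ Submodule.span ℝ s).map (massOp m) := by
  obtain ⟨c, hc⟩ := hq.gradient_eq
  have h : LinearMap.range constConfig ⊔ Submodule.span ℝ s ≤
      ((LinearMap.range constConfig ⊔ Submodule.span ℝ s).map (massOp m)).comap (hessU m q) := by
    refine sup_le ?_ (Submodule.span_le.2 fun x hx => ?_)
    · rintro _ ⟨v, rfl⟩
      have := hessU_diagonal m hq.collisionFree v
      rw [Submodule.mem_comap]
      refine (congrArg (· ∈ _) this).mpr ?_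
      exact Submodule.zero_mem _
    · have hx' : x ∈ LinearMap.range constConfig ⊔ Submodule.span ℝ s :=
        Submodule.mem_sup_right (Submodule.subset_span hx)
      rw [SetLike.mem_coe, Submodule.mem_comap]
      rcases hs x hx with rfl | ⟨a, ha, rfl⟩
      · rw [hessU_self m hq.collisionFree, hc, ← map_smul]
        exact Submodule.mem_map_of_mem (Submodule.smul_mem _ _ (Submodule.smul_mem _ _ hx'))
      · rw [hessU_skew m hq.collisionFree ha, hc, diagAct_massOp, map_smul (diagAct a)]
        exact Submodule.mem_map_of_mem (Submodule.smul_mem _ _ hx')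
  exact fun x hx => h hx

theorem hessU_mem_quat {m : Fin n → ℝ} {q : Config n} (hq : IsCentralConfiguration m q) :
    ∀ x ∈ LinearMap.range constConfig ⊔ quatSpan q,
      hessU m q x ∈ (LinearMap.range constConfig ⊔ quatSpan q).map (massOp m) := by
  refine hessU_mem_sup hq ?_
  rintro x ⟨a, ha, rfl⟩
  rcases eq_one_or_skew ha with rfl | h
  · exact Or.inl (diagAct_one_apply q)
  · exact Or.inr ⟨_, inner_toEuclideanLin_of_skew h, rfl⟩

theorem hessU_mem_rot {m : Fin n → ℝ} {q : Config n} (hq : IsCentralConfiguration m q) :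
    ∀ x ∈ LinearMap.range constConfig ⊔ rotSpan q,
      hessU m q x ∈ (LinearMap.range constConfig ⊔ rotSpan q).map (massOp m) := by
  refine hessU_mem_sup hq ?_
  rintro x (rfl | ⟨l, r, -, rfl⟩)
  · exact Or.inl rfl
  · exact Or.inr ⟨_, inner_toEuclideanLin_of_skew (transpose_genRot l r), rfl⟩

end RelEq

/-! ### Positions and angular speed -/

namespace RelEq

variable {n : ℕ} {m : Fin n → ℝ} {q : Config n}

theorem exists_ne_zero (hn : 3 ≤ n) (hq : IsCentralConfiguration m q) : ∃ i, q i ≠ 0 := by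
  by_contra! h
  exact hq.collisionFree ⟨0, by omega⟩ ⟨1, by omega⟩ (by simp) ((h _).trans (h _).symm)

theorem angSpeed_pos (hn : 3 ≤ n) (hm : ∀ i, 0 < m i) (hq : IsCentralConfiguration m q) :
    0 < angSpeed m q := by
  refine Real.sqrt_pos.2 (div_pos ?_ ?_)
  · have hterm : ∀ i, ∀ j ∈ Finset.Ioi i, 0 < m i * m j / ‖q i - q j‖ := fun i j hj =>
      div_pos (mul_pos (hm i) (hm j)) (norm_pos_iff.2 (sub_ne_zero.2
        (hq.collisionFree i j (Finset.mem_Ioi.1 hj).ne)))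
    refine Finset.sum_pos' (fun i _ => Finset.sum_nonneg fun j hj => (hterm i j hj).le)
      ⟨⟨0, by omega⟩, Finset.mem_univ _, Finset.sum_pos (hterm _) ⟨⟨1, by omega⟩, ?_⟩⟩
    simp
  · obtain ⟨i, hi⟩ := exists_ne_zero hn hq
    rw [inertia, inner_massOp]
    exact Finset.sum_pos' (fun j _ => mul_nonneg (hm j).le real_inner_self_nonneg)
      ⟨i, Finset.mem_univ i, mul_pos (hm i) (real_inner_self_pos.2 hi)⟩

theorem genDouble_eq (m : Fin n → ℝ) (q : Config n) : genDouble m q = angSpeed m q • opI := rfl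

theorem smul_opI_skew (c : ℝ) (x y : E4) :
    inner ℝ ((c • opI) x) y = -inner ℝ x ((c • opI) y) := by
  rw [LinearMap.smul_apply, LinearMap.smul_apply, real_inner_smul_left, real_inner_smul_right,
    opI_skew, mul_neg]

/-! ### Dimension bounds -/

/-- The quaternion multiples of a nonzero vector form an orthogonal frame of `ℝ⁴`, so the position
of one body off the origin can be prescribed at will. -/
theorem quatSpan_eval_surjective {i : Fin n} (hi : q i ≠ 0) (y : E4) :
    ∃ x ∈ quatSpan q, x i = y := by
  refine ⟨(‖q i‖ ^ 2)⁻¹ • (inner ℝ (q i) y • q +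
    inner ℝ (Matrix.toEuclideanLin quatI (q i)) y • diagAct (Matrix.toEuclideanLin quatI) q +
    inner ℝ (Matrix.toEuclideanLin quatJ (q i)) y • diagAct (Matrix.toEuclideanLin quatJ) q +
    inner ℝ (Matrix.toEuclideanLin quatK (q i)) y • diagAct (Matrix.toEuclideanLin quatK) q),
    ?_, ?_⟩
  · refine Submodule.smul_mem _ _ (add_mem (add_mem (add_mem ?_ ?_) ?_) ?_) <;>
      refine Submodule.smul_mem _ _ ?_
    · exact self_mem_quatSpan q
    all_goals exact diagAct_mem_quatSpan (by simp) q
  · simp only [PiLp.smul_apply, PiLp.add_apply, diagAct_apply]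
    rw [← quaternion_frame, inv_smul_smul₀]
    exact pow_ne_zero 2 (norm_ne_zero_iff.2 hi)

theorem finrank_quatSpan_ge {i : Fin n} (hi : q i ≠ 0) : 4 ≤ Module.finrank ℝ (quatSpan q) := by
  let f : quatSpan q →ₗ[ℝ] E4 :=
    { toFun := fun x => (x : Config n) i
      map_add' := fun _ _ => rfl
      map_smul' := fun _ _ => rfl }
  have hf : Function.Surjective f := fun y => by
    obtain ⟨x, hx, hxy⟩ := quatSpan_eval_surjective hi y
    exact ⟨⟨x, hx⟩, hxy⟩
  simpa using LinearMap.finrank_le_finrank_of_surjective hf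

theorem sum_mass_smul_eq_zero (hq : IsCentralConfiguration m q) :
    ∀ x ∈ rotSpan q, ∑ i, m i • x i = 0 := by
  let f : Config n →ₗ[ℝ] E4 :=
    { toFun := fun x => ∑ i, m i • x i
      map_add' := fun x y => by simp [Finset.sum_add_distrib]
      map_smul' := fun c x => by
        simp only [PiLp.smul_apply, RingHom.id_apply, Finset.smul_sum]
        exact Finset.sum_congr rfl fun i _ => smul_comm _ _ _ }
  have h : rotSpan q ≤ LinearMap.ker f := by
    refine Submodule.span_le.2 ?_
    rintro x (rfl | ⟨l, r, -, rfl⟩)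
    · exact hq.center
    · have : ∑ i, m i • Matrix.toEuclideanLin (genRot l r) (q i) = 0 := by
        simp_rw [← map_smul, ← map_sum, hq.center, map_zero]
      exact this
  exact fun x hx => h hx

/-- Everything in `rotSpan q` has its centre of mass at the origin, whereas a constant configuration
with that property vanishes; hence the sum is direct. -/
theorem finrank_const_sup (hn : 3 ≤ n) (hm : ∀ i, 0 < m i) (hq : IsCentralConfiguration m q)
    {S : Submodule ℝ (Config n)} (hS : S ≤ rotSpan q) :
    Module.finrank ℝ ↥(LinearMap.range constConfig ⊔ S) = 4 + Module.finrank ℝ S := by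
  have hd : LinearMap.range constConfig ⊓ S = ⊥ := by
    rw [eq_bot_iff]
    rintro _ ⟨⟨v, rfl⟩, hv⟩
    have := sum_mass_smul_eq_zero hq _ (hS hv)
    simp only [constConfig_apply, ← Finset.sum_smul] at this
    have hpos : 0 < ∑ i, m i :=
      Finset.sum_pos (fun i _ => hm i) ⟨⟨0, by omega⟩, Finset.mem_univ _⟩
    rw [(smul_eq_zero.1 this).resolve_left hpos.ne', map_zero]
    exact Submodule.zero_mem _
  have hinj : Function.Injective (constConfig (n := n)) := fun v w h =>
    congrArg (fun x : Config n => x ⟨0, by omega⟩) h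
  have := Submodule.finrank_sup_add_finrank_inf_eq (LinearMap.range (constConfig (n := n))) S
  rw [hd, finrank_bot, LinearMap.finrank_range_of_inj hinj] at this
  simpa using this

/-! ### Planar relative equilibria -/

theorem relEquilibrium_apply (m : Fin n → ℝ) (q : Config n) (t : ℝ) (i : Fin n) :
    relEquilibrium m q t i = Matrix.toEuclideanLin (doubleRotation (angSpeed m q * t)) (q i) := rfl

theorem mem_motionSpan (m : Fin n → ℝ) (q : Config n) (i : Fin n) : q i ∈ motionSpan m q := by
  refine Submodule.subset_span ⟨0, i, ?_⟩
  have : doubleRotation 0 = 1 := by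
    ext i j; fin_cases i <;> fin_cases j <;> simp [doubleRotation]
  rw [relEquilibrium_apply, mul_zero, this, toEuclideanLin_one_apply]

/-- Multiplication by `i` is a quarter period of the motion, that is, a time shift. This makes the
span of the motion invariant under `opI`. -/
theorem quatI_mul_doubleRotation (φ : ℝ) :
    quatI * doubleRotation φ = doubleRotation (φ + Real.pi / 2) := by
  simp only [doubleRotation, Real.cos_add_pi_div_two, Real.sin_add_pi_div_two]
  ext i j
  fin_cases i <;> fin_cases j <;> simp [quatI, Matrix.mul_apply, Fin.sum_univ_four]

theorem opI_relEquilibrium (hk : 0 < angSpeed m q) (t : ℝ) (i : Fin n) :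
    opI (relEquilibrium m q t i) = relEquilibrium m q (t + Real.pi / 2 / angSpeed m q) i := by
  have h : angSpeed m q * (t + Real.pi / 2 / angSpeed m q) = angSpeed m q * t + Real.pi / 2 := by
    rw [mul_add, mul_div_cancel₀ _ hk.ne']
  rw [relEquilibrium_apply, relEquilibrium_apply, opI, toEuclideanLin_mul_apply,
    quatI_mul_doubleRotation, h]

theorem opI_mem_motionSpan (hk : 0 < angSpeed m q) {x : E4} (hx : x ∈ motionSpan m q) :
    opI x ∈ motionSpan m q := by
  have h : motionSpan m q ≤ (motionSpan m q).comap opI := by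
    rw [motionSpan, Submodule.span_le]
    rintro _ ⟨t, i, rfl⟩
    rw [SetLike.mem_coe, Submodule.mem_comap, opI_relEquilibrium hk]
    exact Submodule.subset_span ⟨_, i, rfl⟩
  exact Submodule.mem_comap.1 (h hx)

theorem IsPlanarRE.finrank_motionSpan_le (h : IsPlanarRE m q) :
    Module.finrank ℝ (motionSpan m q) ≤ 2 := by
  obtain ⟨P, hP, hmem⟩ := h
  rw [← hP]
  refine Submodule.finrank_mono (Submodule.span_le.2 ?_)
  rintro _ ⟨t, i, rfl⟩
  exact hmem t i

section Plane

variable {P : Submodule ℝ E4}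

theorem starProjection_opI (hP : ∀ x ∈ P, opI x ∈ P) (x : E4) :
    P.starProjection (opI x) = opI (P.starProjection x) := by
  refine Submodule.eq_starProjection_of_mem_of_inner_eq_zero
    (hP _ (P.starProjection_apply_mem x)) fun w hw => ?_
  rw [← map_sub, opI_skew, P.starProjection_inner_eq_zero x _ (hP w hw), neg_zero]

theorem starProjection_of_mem {x : E4} (hx : x ∈ P) : P.starProjection x = x :=
  P.starProjection_eq_self_iff.2 hx

theorem genSimple_apply (m : Fin n → ℝ) (q : Config n) (x : E4) :
    genSimple m q x = angSpeed m q • opI ((motionSpan m q).starProjection x) := rfl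

theorem opI_starProjection_skew (hP : ∀ x ∈ P, opI x ∈ P) (x y : E4) :
    inner ℝ (opI (P.starProjection x)) y = -inner ℝ x (opI (P.starProjection y)) := by
  rw [← starProjection_opI hP, P.inner_starProjection_left_eq_right, opI_skew]

/-- A plane invariant under `opI` is spanned by `e` and `opI e`. -/
theorem exists_eq_add_opI (hP : ∀ x ∈ P, opI x ∈ P) (hfin : Module.finrank ℝ P ≤ 2) {e : E4}
    (he : e ∈ P) (he0 : e ≠ 0) {x : E4} (hx : x ∈ P) : ∃ α β : ℝ, x = α • e + β • opI e := by
  have hee : inner ℝ e (opI e) = 0 := inner_skew_self opI_skew e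
  have hli : LinearIndependent ℝ ![e, opI e] := by
    refine LinearIndependent.pair_iff.2 fun s t hst => ?_
    have h1 := congrArg (fun z => inner ℝ e z) hst
    have h2 := congrArg (fun z => inner ℝ (opI e) z) hst
    simp only [inner_add_right, real_inner_smul_right, hee, mul_zero, add_zero, zero_add,
      inner_zero_right, real_inner_comm e (opI e), real_inner_self_eq_norm_sq, norm_opI] at h1 h2
    have hne : ‖e‖ ^ 2 ≠ 0 := pow_ne_zero 2 (norm_ne_zero_iff.2 he0)
    exact ⟨(mul_eq_zero.1 h1).resolve_right hne, (mul_eq_zero.1 h2).resolve_right hne⟩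
  have hle : Submodule.span ℝ {e, opI e} ≤ P := by
    rw [Submodule.span_le]
    rintro _ (rfl | rfl)
    · exact he
    · exact hP e he
  have hcard : Module.finrank ℝ (Submodule.span ℝ {e, opI e}) = 2 := by
    have := finrank_span_eq_card hli
    rwa [Matrix.range_cons, Matrix.range_cons, Matrix.range_empty, Set.union_empty,
      Set.singleton_union, Fintype.card_fin] at this
  have heq := Submodule.eq_of_le_of_finrank_le hle (by rw [hcard]; exact hfin)
  rw [← heq] at hx
  obtain ⟨α, β, h⟩ := Submodule.mem_span_pair.1 hx
  exact ⟨α, β, h.symm⟩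

/-- The compression of a skew operator to a plane is a multiple of the rotation. -/
theorem exists_starProjection_skew (hP : ∀ x ∈ P, opI x ∈ P) (hfin : Module.finrank ℝ P ≤ 2)
    {e : E4} (he : e ∈ P) (he0 : e ≠ 0) {a : E4 →ₗ[ℝ] E4}
    (ha : ∀ x y, inner ℝ (a x) y = -inner ℝ x (a y)) :
    ∃ c : ℝ, ∀ x ∈ P, P.starProjection (a x) = c • opI x := by
  have hne : ‖e‖ ^ 2 ≠ 0 := pow_ne_zero 2 (norm_ne_zero_iff.2 he0)
  -- In the orthogonal basis `e`, `opI e` a skew form on the plane is determined by the one entry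
  -- `⟨ae, opI e⟩`; the residual is tested against that basis.
  refine ⟨inner ℝ (a e) (opI e) / ‖e‖ ^ 2, fun x hx => ?_⟩
  refine P.eq_starProjection_of_mem_of_inner_eq_zero (P.smul_mem _ (hP x hx)) fun w hw => ?_
  obtain ⟨α, β, rfl⟩ := exists_eq_add_opI hP hfin he he0 hx
  obtain ⟨s, t, rfl⟩ := exists_eq_add_opI hP hfin he he0 hw
  have h1 : inner ℝ (a e) e = 0 := by rw [real_inner_comm]; exact inner_skew_self ha e
  have h2 : inner ℝ (a (opI e)) (opI e) = 0 := by rw [real_inner_comm]; exact inner_skew_self ha _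
  have h3 : inner ℝ (a (opI e)) e = -inner ℝ (a e) (opI e) := by rw [ha, real_inner_comm]
  have h4 : inner ℝ e (opI e) = 0 := inner_skew_self opI_skew e
  have h5 : inner ℝ (opI e) e = 0 := by rw [real_inner_comm]; exact h4
  have h6 : inner ℝ (opI e) (opI e) = ‖e‖ ^ 2 := by rw [real_inner_self_eq_norm_sq, norm_opI]
  have h7 : inner ℝ e e = ‖e‖ ^ 2 := real_inner_self_eq_norm_sq e
  simp only [map_add, map_smul, inner_add_left, inner_add_right, inner_sub_left,
    real_inner_smul_left, real_inner_smul_right, opI_opI, inner_neg_left, h1, h2, h3, h4, h5, h6, h7]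
  field_simp
  ring

end Plane

theorem genSimple_skew (hk : 0 < angSpeed m q) (x y : E4) :
    inner ℝ (genSimple m q x) y = -inner ℝ x (genSimple m q y) := by
  rw [genSimple_apply, genSimple_apply, real_inner_smul_left, real_inner_smul_right,
    opI_starProjection_skew fun _ h => opI_mem_motionSpan hk h, mul_neg]

/-- The generator sees only the part of `K_{lr} q` tangent to the plane. That part is a multiple of
`opI q`, so applying `opI` again returns a multiple of `q`. -/
theorem genSimple_mem_rotSpan (hk : 0 < angSpeed m q) (hp : IsPlanarRE m q) {i : Fin n}
    (hi : q i ≠ 0) : ∀ x ∈ rotSpan q, diagAct (genSimple m q) x ∈ rotSpan q := by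
  have hP : ∀ x ∈ motionSpan m q, opI x ∈ motionSpan m q := fun _ h => opI_mem_motionSpan hk h
  have h : rotSpan q ≤ (rotSpan q).comap (diagAct (genSimple m q)) := by
    refine Submodule.span_le.2 ?_
    rintro x (rfl | ⟨l, r, -, rfl⟩)
    · exact diagAct_mem_rotSpan (genSimple_skew hk) x
    · obtain ⟨c, hc⟩ := exists_starProjection_skew hP hp.finrank_motionSpan_le
        (mem_motionSpan m q i) hi (inner_toEuclideanLin_of_skew (transpose_genRot l r))
      have : diagAct (genSimple m q) (diagAct (Matrix.toEuclideanLin (genRot l r)) q) =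
          (-(angSpeed m q * c)) • q := by
        ext1 j
        rw [diagAct_apply, diagAct_apply, genSimple_apply, hc _ (mem_motionSpan m q j), map_smul,
          opI_opI, smul_neg, smul_neg, smul_smul, PiLp.smul_apply, neg_smul]
      rw [SetLike.mem_coe, Submodule.mem_comap, this]
      exact Submodule.smul_mem _ _ (self_mem_rotSpan q)
  exact fun x hx => h hx

/-- Evaluation at body `i` is onto `ℝ⁴`. Its kernel contains a copy of the normal space of the
plane, of dimension at least 2, obtained from rotations that fix `q i` but move some body off its
line. -/
theorem finrank_rotSpan_ge (hk : 0 < angSpeed m q) (hp : IsPlanarRE m q) (hc : ¬ IsCollinear q)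
    {i : Fin n} (hi : q i ≠ 0) : 6 ≤ Module.finrank ℝ (rotSpan q) := by
  set P := motionSpan m q with hPdef
  have hP : ∀ x ∈ P, opI x ∈ P := fun _ h => opI_mem_motionSpan hk h
  have hqP : ∀ j, q j ∈ P := mem_motionSpan m q
  have hfin : Module.finrank ℝ P ≤ 2 := hp.finrank_motionSpan_le
  let f : rotSpan q →ₗ[ℝ] E4 :=
    { toFun := fun x => (x : Config n) i
      map_add' := fun _ _ => rfl
      map_smul' := fun _ _ => rfl }
  have hf : LinearMap.range f = ⊤ := LinearMap.range_eq_top.2 fun y => by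
    obtain ⟨x, hx, hxy⟩ := quatSpan_eval_surjective hi y
    exact ⟨⟨x, quatSpan_le_rotSpan q hx⟩, hxy⟩
  -- Otherwise every body would be a multiple of `q i`, and `q` would be collinear.
  obtain ⟨j, hj⟩ : ∃ j, inner ℝ (opI (q i)) (q j) ≠ 0 := by
    by_contra! h
    refine hc ((collinear_iff_exists_forall_eq_smul_vadd _).2 ⟨0, q i, ?_⟩)
    rintro _ ⟨j, rfl⟩
    obtain ⟨α, β, hαβ⟩ := exists_eq_add_opI hP hfin (hqP i) hi (hqP j)
    have h1 := h j
    rw [hαβ, inner_add_right, real_inner_smul_right, real_inner_smul_right, real_inner_comm,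
      inner_skew_self opI_skew, mul_zero, zero_add, real_inner_self_eq_norm_sq, norm_opI] at h1
    have hβ : β = 0 :=
      (mul_eq_zero.1 h1).resolve_right (pow_ne_zero 2 (norm_ne_zero_iff.2 hi))
    refine ⟨α, ?_⟩
    show q j = _
    rw [hαβ, hβ]
    simp
  have hwedge : ∀ v ∈ Pᗮ,
      (WithLp.toLp 2 fun l => inner ℝ (opI (q i)) (q l) • v : Config n) ∈ rotSpan q := by
    intro v hv
    -- The infinitesimal rotation in the plane of `opI (q i)` and the normal vector `v`; its second
    -- term vanishes on the plane of motion, and its first term vanishes at `q i`.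
    let a : E4 →ₗ[ℝ] E4 :=
      { toFun := fun x => inner ℝ (opI (q i)) x • v - inner ℝ v x • opI (q i)
        map_add' := fun x y => by
          rw [inner_add_right, inner_add_right, add_smul, add_smul]; abel
        map_smul' := fun c x => by
          rw [real_inner_smul_right, real_inner_smul_right, mul_smul, mul_smul, RingHom.id_apply,
            smul_sub] }
    have ha : ∀ x y, inner ℝ (a x) y = -inner ℝ x (a y) := fun x y => by
      simp only [a, LinearMap.coe_mk, AddHom.coe_mk, inner_sub_left, inner_sub_right,
        real_inner_smul_left, real_inner_smul_right, real_inner_comm v x,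
        real_inner_comm (opI (q i)) x]
      ring
    have := diagAct_mem_rotSpan ha q
    convert this using 1
    ext1 l
    have hvl : inner ℝ v (q l) = 0 := by
      rw [real_inner_comm]; exact (Submodule.mem_orthogonal P v).1 hv _ (hqP l)
    simp [a, hvl]
  let g : Pᗮ →ₗ[ℝ] LinearMap.ker f :=
    { toFun := fun v => ⟨⟨_, hwedge v v.2⟩, by
        show inner ℝ (opI (q i)) (q i) • (v : E4) = 0
        rw [real_inner_comm, inner_skew_self opI_skew, zero_smul]⟩
      map_add' := fun v w => by
        ext1; ext1; ext1 l
        exact smul_add _ _ _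
      map_smul' := fun c v => by
        ext1; ext1; ext1 l
        exact smul_comm _ _ _ }
  have hg : Function.Injective g := fun v w h => by
    have h1 : inner ℝ (opI (q i)) (q j) • (v : E4) = inner ℝ (opI (q i)) (q j) • (w : E4) :=
      congrArg (fun x : LinearMap.ker f => (x.1 : Config n) j) h
    exact Subtype.ext (smul_right_injective E4 hj h1)
  have h1 := LinearMap.finrank_le_finrank_of_injective hg
  have h2 := LinearMap.finrank_range_add_finrank_ker f
  have h3 := P.finrank_add_finrank_orthogonal
  rw [hf, finrank_top] at h2
  simp only [finrank_euclideanSpace, Fintype.card_fin] at h2 h3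
  omega

/-! ### Collinear configurations -/

/-- The line contains the centre of mass, which is the origin. -/
theorem IsCollinear.exists_eq_smul (hn : 3 ≤ n) (hm : ∀ i, 0 < m i)
    (hq : IsCentralConfiguration m q) (hc : IsCollinear q) {i : Fin n} (hi : q i ≠ 0) (j : Fin n) :
    ∃ c : ℝ, q j = c • q i := by
  obtain ⟨p, v, h⟩ := (collinear_iff_exists_forall_eq_smul_vadd _).1 hc
  have h' : ∀ l, ∃ r : ℝ, q l = r • v + p := fun l => h _ ⟨l, rfl⟩
  choose r hr using h'
  have hpos : 0 < ∑ i, m i :=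
    Finset.sum_pos (fun i _ => hm i) ⟨⟨0, by omega⟩, Finset.mem_univ _⟩
  have h0 := hq.center
  simp_rw [hr, smul_add, smul_smul, Finset.sum_add_distrib, ← Finset.sum_smul] at h0
  have hp : p = (-((∑ l, m l)⁻¹ * ∑ l, m l * r l)) • v := by
    rw [neg_smul, mul_smul, eq_neg_of_add_eq_zero_left h0, smul_neg, neg_neg,
      inv_smul_smul₀ hpos.ne']
  have hs : ∀ l, ∃ s : ℝ, q l = s • v := fun l => ⟨r l + -((∑ l, m l)⁻¹ * ∑ l, m l * r l), by
    rw [add_smul, ← hp]; exact hr l⟩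
  choose s hs using hs
  have hsi : s i ≠ 0 := fun h => hi (by rw [hs, h, zero_smul])
  exact ⟨s j / s i, by rw [hs i, smul_smul, div_mul_cancel₀ _ hsi]; exact hs j⟩

/-- A linear image of a collinear `q` is determined by its value at one body off the origin, and
`quatSpan q` already realizes every such value. Consequently `rotSpan` and `quatSpan`, and with them
`E3s` and `E3d`, coincide. -/
theorem IsCollinear.diagAct_mem_quatSpan (hn : 3 ≤ n) (hm : ∀ i, 0 < m i)
    (hq : IsCentralConfiguration m q) (hc : IsCollinear q) (a : E4 →ₗ[ℝ] E4) :
    diagAct a q ∈ quatSpan q := by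
  obtain ⟨i, hi⟩ := exists_ne_zero hn hq
  obtain ⟨x, hx, hxi⟩ := quatSpan_eval_surjective hi (a (q i))
  choose c hcq using hc.exists_eq_smul hn hm hq hi
  have hprop : ∀ y ∈ quatSpan q, ∀ j, y j = c j • y i := by
    intro y hy j
    have h : quatSpan q ≤ LinearMap.ker
        ({ toFun := fun y => y j - c j • y i
           map_add' := fun y z => by simp only [PiLp.add_apply, smul_add]; abel
           map_smul' := fun t y => by
            simp only [PiLp.smul_apply, RingHom.id_apply, smul_sub, smul_comm t (c j)] } :
          Config n →ₗ[ℝ] E4) := by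
      refine Submodule.span_le.2 ?_
      rintro _ ⟨b, -, rfl⟩
      show Matrix.toEuclideanLin b (q j) - c j • Matrix.toEuclideanLin b (q i) = 0
      rw [hcq j, map_smul, sub_self]
    exact sub_eq_zero.1 (h hy)
  convert hx using 1
  ext1 j
  rw [hprop x hx j, hxi, diagAct_apply, hcq j, map_smul]

theorem IsCollinear.rotSpan_eq (hn : 3 ≤ n) (hm : ∀ i, 0 < m i)
    (hq : IsCentralConfiguration m q) (hc : IsCollinear q) : rotSpan q = quatSpan q := by
  refine le_antisymm (Submodule.span_le.2 ?_) (quatSpan_le_rotSpan q)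
  rintro x (rfl | ⟨l, r, -, rfl⟩)
  · exact self_mem_quatSpan x
  · exact hc.diagAct_mem_quatSpan hn hm hq _

theorem IsCollinear.diagAct_mem_quatSpan_of_mem (hn : 3 ≤ n) (hm : ∀ i, 0 < m i)
    (hq : IsCentralConfiguration m q) (hc : IsCollinear q) (a : E4 →ₗ[ℝ] E4) :
    ∀ x ∈ quatSpan q, diagAct a x ∈ quatSpan q := by
  have h : quatSpan q ≤ (quatSpan q).comap (diagAct a) := by
    refine Submodule.span_le.2 ?_
    rintro _ ⟨b, -, rfl⟩
    exact hc.diagAct_mem_quatSpan hn hm hq (a ∘ₗ Matrix.toEuclideanLin b)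
  exact fun x hx => h hx

/-! ### The rotation of the complementary plane -/

/-- The infinitesimal rotation of the orthogonal complement of the motion plane. -/
noncomputable def perpRot (P : Submodule ℝ E4) : E4 →ₗ[ℝ] E4 :=
  opI ∘ₗ (LinearMap.id - P.starProjection.toLinearMap)

theorem perpRot_apply (P : Submodule ℝ E4) (x : E4) :
    perpRot P x = opI (x - P.starProjection x) := rfl

section Perp

variable {P : Submodule ℝ E4}

theorem perpRot_eq (P : Submodule ℝ E4) (x : E4) :
    perpRot P x = opI x - opI (P.starProjection x) := by
  rw [perpRot_apply, map_sub]

theorem perpRot_skew (hP : ∀ x ∈ P, opI x ∈ P) (x y : E4) :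
    inner ℝ (perpRot P x) y = -inner ℝ x (perpRot P y) := by
  rw [perpRot_eq, perpRot_eq, inner_sub_left, inner_sub_right, opI_skew,
    opI_starProjection_skew hP]
  ring

theorem starProjection_starProjection (x : E4) :
    P.starProjection (P.starProjection x) = P.starProjection x :=
  starProjection_of_mem (P.starProjection_apply_mem x)

theorem starProjection_perpRot (hP : ∀ x ∈ P, opI x ∈ P) (x : E4) :
    P.starProjection (perpRot P x) = 0 := by
  rw [perpRot_apply, starProjection_opI hP, map_sub, starProjection_starProjection, sub_self,
    map_zero]

theorem perpRot_perpRot (hP : ∀ x ∈ P, opI x ∈ P) (x : E4) :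
    perpRot P (perpRot P x) = -(x - P.starProjection x) := by
  rw [perpRot_eq P (perpRot P x), starProjection_perpRot hP, map_zero, sub_zero, perpRot_apply,
    opI_opI]

theorem perpRot_of_mem {x : E4} (hx : x ∈ P) : perpRot P x = 0 := by
  rw [perpRot_apply, starProjection_of_mem hx, sub_self, map_zero]

/-- The quarter turn of the orthogonal complement of the plane `P`. -/
noncomputable def quarterTurn (hP : ∀ x ∈ P, opI x ∈ P) : E4 ≃ₗᵢ[ℝ] E4 :=
  LinearIsometry.toLinearIsometryEquiv
    { toLinearMap := P.starProjection.toLinearMap + perpRot P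
      norm_map' := fun x => by
        have h1 : inner ℝ (P.starProjection x) (perpRot P x) = 0 := by
          rw [P.inner_starProjection_left_eq_right, starProjection_perpRot hP, inner_zero_right]
        have h2 : inner ℝ (P.starProjection x) (x - P.starProjection x) = 0 := by
          rw [real_inner_comm]
          exact P.starProjection_inner_eq_zero x _ (P.starProjection_apply_mem x)
        have e1 := norm_add_sq_eq_norm_sq_add_norm_sq_real h1
        have e2 := norm_add_sq_eq_norm_sq_add_norm_sq_real h2
        rw [perpRot_apply, norm_opI, ← perpRot_apply, ← e2, add_sub_cancel] at e1
        exact (mul_self_inj (norm_nonneg _) (norm_nonneg _)).1 e1 }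
    rfl

theorem quarterTurn_apply (hP : ∀ x ∈ P, opI x ∈ P) (x : E4) :
    quarterTurn hP x = P.starProjection x + perpRot P x := rfl

/-- The quarter turn `R` of the normal space fixes every `q i`, so the Hessian commutes with it. As
`R = 1` on `P` and `R² = -1` on the complement, `perpRot` is the polynomial `(2R - 1 - R²)/2` in
`R`. -/
theorem hessU_perpRot (hP : ∀ x ∈ P, opI x ∈ P) (hqP : ∀ i, q i ∈ P) (x : Config n) :
    hessU m q (diagAct (perpRot P) x) = diagAct (perpRot P) (hessU m q x) := by
  set R := quarterTurn hP
  have hR : ∀ x, hessU m q (diagAct R.toLinearEquiv.toLinearMap x) =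
      diagAct R.toLinearEquiv.toLinearMap (hessU m q x) :=
    hessU_diagAct_isometry m R fun i => by
      rw [quarterTurn_apply, perpRot_of_mem (hqP i), add_zero, starProjection_of_mem (hqP i)]
  have hpt : ∀ x : E4, (2 : ℝ) • perpRot P x = (2 : ℝ) • R x - x - R (R x) := fun x => by
    simp only [R, quarterTurn_apply, map_add, starProjection_perpRot hP, perpRot_perpRot hP,
      starProjection_starProjection, perpRot_of_mem (P.starProjection_apply_mem x)]
    module
  have hcfg : ∀ x : Config n, diagAct (perpRot P) x = (2 : ℝ)⁻¹ •
      ((2 : ℝ) • diagAct R.toLinearEquiv.toLinearMap x - x -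
        diagAct R.toLinearEquiv.toLinearMap (diagAct R.toLinearEquiv.toLinearMap x)) := fun x => by
    ext1 i
    have := hpt (x i)
    simp only [PiLp.smul_apply, PiLp.sub_apply, diagAct_apply, LinearEquiv.coe_coe,
      LinearIsometryEquiv.coe_toLinearEquiv]
    rw [← this, inv_smul_smul₀ two_ne_zero]
  rw [hcfg x, hcfg (hessU m q x)]
  simp only [map_smul, map_sub, hR]

end Perp

/-! ### Parity for stable relative equilibria -/

/-- The spectral input is the absence of nonzero real eigenvalues rather than stability, because for
planar motion stability refers to the other frame. The exponent is `8n - 2(4 + 4)`. -/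
theorem even_of_stable_genDouble (hn : 3 ≤ n) (hm : ∀ i, 0 < m i)
    (hq : IsCentralConfiguration m q)
    (hno : ∀ μ : ℝ, ∀ z ∈ E3d m q, μ ≠ 0 → hamL m q (genDouble m q) z = μ • z → z = 0) :
    Even ((indexB3Ker m q (genDouble m q) (E3d m q) (8 * n - 16) : ℤ) -
      indexB3 m q (genDouble m q) (E3d m q)) := by
  obtain ⟨i, hi⟩ := exists_ne_zero hn hq
  rw [E3d_eq] at hno ⊢
  refine even_indexB3Ker_sub_indexB3 hm (smul_opI_skew _) (hessU_symm m hq.collisionFree)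
    (diagAct_mem_sup _ (diagAct_opI_mem_quatSpan _ q)) (hessU_mem_quat hq) hno ?_
  rw [finrank_const_sup hn hm hq (quatSpan_le_rotSpan q)]
  have := finrank_quatSpan_ge hi
  omega

theorem even_of_stable_genSimple (hn : 3 ≤ n) (hm : ∀ i, 0 < m i)
    (hq : IsCentralConfiguration m q) (hp : IsPlanarRE m q)
    (hs : IsStableOn (hamL m q (genSimple m q)) (E3s m q)) {N : ℕ}
    (hN : 8 * n ≤ N + 2 * (4 + Module.finrank ℝ (rotSpan q))) :
    Even ((indexB3Ker m q (genSimple m q) (E3s m q) N : ℤ) -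
      indexB3 m q (genSimple m q) (E3s m q)) := by
  obtain ⟨i, hi⟩ := exists_ne_zero hn hq
  have hk := angSpeed_pos hn hm hq
  rw [E3s_eq] at hs ⊢
  refine even_indexB3Ker_sub_indexB3 hm (genSimple_skew hk) (hessU_symm m hq.collisionFree)
    (diagAct_mem_sup _ (genSimple_mem_rotSpan hk hp hi)) (hessU_mem_rot hq)
    (fun μ z hz hμ hL => hs.eq_zero_of_real_eigenvector hz hμ hL) ?_
  rwa [finrank_const_sup hn hm hq le_rfl]

/-- For a planar relative equilibrium of a collinear configuration, stability in the simple
rotating frame excludes nonzero real eigenvalues in the double rotating frame. -/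
theorem IsCollinear.eq_zero_of_real_eigenvector_genDouble (hn : 3 ≤ n) (hm : ∀ i, 0 < m i)
    (hq : IsCentralConfiguration m q) (hc : IsCollinear q)
    (hs : IsStableOn (hamL m q (genSimple m q)) (E3s m q)) {μ : ℝ} {z : Phase n}
    (hz : z ∈ E3d m q) (hμ : μ ≠ 0) (hL : hamL m q (genDouble m q) z = μ • z) : z = 0 := by
  have hk := angSpeed_pos hn hm hq
  have hP : ∀ x ∈ motionSpan m q, opI x ∈ motionSpan m q := fun _ h => opI_mem_motionSpan hk h
  rw [E3s_eq, hc.rotSpan_eq hn hm hq, ← E3d_eq] at hs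
  set k := angSpeed m q with hkdef
  set b := perpRot (motionSpan m q) with hb
  -- `C` is the difference of the two frames: the rotation at speed `k` of the space normal to the
  -- motion, acting on positions and momenta alike.
  let C : Phase n →ₗ[ℝ] Phase n := (diagAct (k • b)).prodMap (diagAct (k • b))
  have hCapp : ∀ z, C z = (diagAct (k • b) z.1, diagAct (k • b) z.2) := fun z => rfl
  have hbs : ∀ x y, inner ℝ ((k • b) x) y = -inner ℝ x ((k • b) y) := fun x y => by
    rw [LinearMap.smul_apply, LinearMap.smul_apply, real_inner_smul_left, real_inner_smul_right,
      perpRot_skew hP, mul_neg]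
  refine hs.eq_zero_of_real_eigenvector_add (C := C) ?_ ?_ ?_ hk.ne' ?_ hz hμ hL
  · intro z
    have hg : ∀ x : Config n, diagAct (genDouble m q) x =
        diagAct (genSimple m q) x + diagAct (k • b) x := fun x => by
      ext1 i
      simp only [PiLp.add_apply, diagAct_apply, LinearMap.smul_apply, genSimple_apply, hb,
        perpRot_eq, genDouble_eq, ← hkdef]
      module
    rw [hamL_apply, hamL_apply, hCapp, hg, hg, Prod.mk_add_mk]
    congr 1 <;> abel
  -- The simple generator and `perpRot` act on complementary subspaces, so their products vanish in
  -- both orders; the Hessian commutes with `perpRot` by `hessU_perpRot`.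
  · intro z
    have hg1 : ∀ x : Config n, diagAct (genSimple m q) (diagAct (k • b) x) = 0 := fun x => by
      ext1 i
      simp only [diagAct_apply, LinearMap.smul_apply, map_smul]
      rw [genSimple_apply, starProjection_perpRot hP]
      simp
    have hg2 : ∀ x : Config n, diagAct (k • b) (diagAct (genSimple m q) x) = 0 := fun x => by
      ext1 i
      simp only [diagAct_apply, LinearMap.smul_apply]
      rw [genSimple_apply, map_smul, hb,
        perpRot_of_mem (hP _ ((motionSpan m q).starProjection_apply_mem _))]
      simp
    have hg3 : ∀ x : Config n, hessU m q (diagAct (k • b) x) = diagAct (k • b) (hessU m q x) :=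
      fun x => by
        rw [diagAct_smul_apply, map_smul, hessU_perpRot hP (mem_motionSpan m q),
          diagAct_smul_apply]
    rw [hCapp, hCapp, hamL_apply, hamL_apply]
    simp only [map_add, hg1, hg2, hg3, diagAct_massInv, zero_add, add_zero]
  -- `C` is skew for `ω`, so it preserves the complement once it preserves the space over
  -- translations and quaternion multiples.
  · intro z hz
    rw [E3d_eq] at hz ⊢
    refine mem_orthogonal_of_skew (fun z w => ?_) (fun z hz => ?_) hz
    · simp only [omega_apply, hCapp, inner_diagAct_of_skew hbs]
      ring
    · obtain ⟨x, p⟩ := z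
      obtain ⟨hx, ⟨y, hy, rfl : massOp m y = p⟩⟩ := hz
      have hT := diagAct_mem_sup (k • b) (hc.diagAct_mem_quatSpan_of_mem hn hm hq (k • b))
      refine ⟨hT x hx, ?_⟩
      show diagAct (k • b) (massOp m y) ∈ _
      rw [diagAct_massOp]
      exact Submodule.mem_map_of_mem (hT y hy)
  · intro z
    have hg : ∀ x : Config n, diagAct (k • b) (diagAct (k • b) (diagAct (k • b) x)) =
        -(k ^ 2) • diagAct (k • b) x := fun x => by
      ext1 i
      simp only [PiLp.smul_apply, diagAct_apply, LinearMap.smul_apply, map_smul]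
      rw [hb, perpRot_perpRot hP (perpRot _ _), starProjection_perpRot hP, sub_zero]
      module
    rw [hCapp, hCapp, hCapp]
    exact Prod.ext (hg _) (hg _)

end RelEq

theorem mainTheorem1 (n : ℕ) (hn : 3 ≤ n) (m : Fin n → ℝ) (hm : ∀ i, 0 < m i)
    (q : RelEq.Config n) (hq : RelEq.IsCentralConfiguration m q) :
    (((¬ RelEq.IsPlanarRE m q ∨ (RelEq.IsPlanarRE m q ∧ RelEq.IsCollinear q)) ∧
        Odd ((RelEq.indexB3Ker m q (RelEq.genDouble m q) (RelEq.E3d m q) (8 * n - 16) : ℤ) -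
          (RelEq.indexB3 m q (RelEq.genDouble m q) (RelEq.E3d m q) : ℤ))) →
      ¬ RelEq.IsSpectrallyStable m q) ∧
    ((RelEq.IsPlanarRE m q ∧ RelEq.IsCollinear q ∧
        Odd ((RelEq.indexB3Ker m q (RelEq.genSimple m q) (RelEq.E3s m q) (8 * n - 16) : ℤ) -
          (RelEq.indexB3 m q (RelEq.genSimple m q) (RelEq.E3s m q) : ℤ))) →
      ¬ RelEq.IsSpectrallyStable m q) ∧
    ((RelEq.IsPlanarRE m q ∧ ¬ RelEq.IsCollinear q ∧
        Odd ((RelEq.indexB3Ker m q (RelEq.genSimple m q) (RelEq.E3s m q) (8 * n - 20) : ℤ) -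
          (RelEq.indexB3 m q (RelEq.genSimple m q) (RelEq.E3s m q) : ℤ))) →
      ¬ RelEq.IsSpectrallyStable m q) := by
  obtain ⟨i, hi⟩ := RelEq.exists_ne_zero hn hq
  refine ⟨?_, ?_, ?_⟩
  · rintro ⟨hcase, hodd⟩ hst
    rw [← Int.not_even_iff_odd] at hodd
    refine hodd (RelEq.even_of_stable_genDouble hn hm hq fun μ z hz hμ hL => ?_)
    rcases hcase with hp | ⟨hp, hc⟩
    · rw [RelEq.IsSpectrallyStable, if_neg hp] at hst
      exact hst.eq_zero_of_real_eigenvector hz hμ hL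
    · rw [RelEq.IsSpectrallyStable, if_pos hp] at hst
      exact hc.eq_zero_of_real_eigenvector_genDouble hn hm hq hst hz hμ hL
  · rintro ⟨hp, -, hodd⟩ hst
    rw [← Int.not_even_iff_odd] at hodd
    rw [RelEq.IsSpectrallyStable, if_pos hp] at hst
    refine hodd (RelEq.even_of_stable_genSimple hn hm hq hp hst ?_)
    -- Since `rotSpan q` contains `quatSpan q`, its dimension is at least 4, which is what the
    -- exponent `8n - 16` needs.
    have h1 := RelEq.finrank_quatSpan_ge hi
    have h2 := Submodule.finrank_mono (RelEq.quatSpan_le_rotSpan q)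
    omega
  · rintro ⟨hp, hc, hodd⟩ hst
    rw [← Int.not_even_iff_odd] at hodd
    rw [RelEq.IsSpectrallyStable, if_pos hp] at hst
    refine hodd (RelEq.even_of_stable_genSimple hn hm hq hp hst ?_)
    have h1 := RelEq.finrank_rotSpan_ge (RelEq.angSpeed_pos hn hm hq) hp hc hi
    omega
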